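/- Let $m\ge 3$, let $U\subset\mathbb R^m$ be open with coordinates $x^\mu$ (a chart domain of an $m$-manifold), $\eta=\mathrm{diag}(1,-1,\dots,-1)$, and let $\mathfrak g=\{M: M^T\Sigma+\Sigma M=0\}$ be the Lie algebra of $O(2,m)$, where $\Sigma=\begin{pmatrix}0&0&-1\\0&\eta&0\\-1&0&0\end{pmatrix}$. For a row $r$ and a column $\tau$ put $r^t=(r\eta^{-1})^T$, $\tau^t=(\eta\tau)^T$. Let $$\varpi=\begin{pmatrix}a&\alpha&0\\ \theta&A&\alpha^t\\0&\theta^t&-a\end{pmatrix}$$ be a smooth conformal Cartan connection on $U$, i.e. a smooth $\mathfrak g$-valued 1-form whose soldering form $\theta^a=e^a{}_\mu dx^\mu$ has invertible vielbein $e$, and let $\Omega=d\varpi+\varpi^2=\tfrac12\Omega_{\mu\sigma}dx^\mu\wedge dx^\sigma$. For matrix-valued functions $u$ write $\varpi^u=u^{-1}\varpi u+u^{-1}du$, $\Omega^u=u^{-1}\Omega u$. With $q=a\cdot e^{-1}$ (that is, $q_b=a_\mu(e^{-1})^\mu{}_b$) define the dressing fields $$u_1=\begin{pmatrix}1&q&\frac12qq^t\\0&1&q^t\\0&0&1\end{pmatrix},\qquad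 u_0=\begin{pmatrix}1&0&0\\0&e&0\\0&0&1\end{pmatrix},$$ the composite fields $\varpi_0=\varpi^{u_1u_0}$, $\Omega_0=\Omega^{u_1u_0}$, and the metric $g=e^T\eta e$. Then $\Omega_0=d\varpi_0+\varpi_0^2$, and $$\varpi_0=\begin{pmatrix}0&P_{\mu\nu}&0\\ \delta^\rho_\mu&\Gamma^\rho{}_{\mu\nu}&g^{\rho\lambda}P_{\mu\lambda}\\0&g_{\mu\nu}&0\end{pmatrix}dx^\mu,\qquad \Omega_0=\tfrac12\begin{pmatrix}(f_0)_{\mu\sigma}&C_{\nu,\mu\sigma}&0\\T^\rho{}_{\mu\sigma}&W^\rho{}_{\nu,\mu\sigma}&g^{\rho\lambda}C_{\lambda,\mu\sigma}\\0&T^\alpha{}_{\mu\sigma}g_{\alpha\nu}&-(f_0)_{\mu\sigma}\end{pmatrix}dx^\mu\wedge dx^\sigma ,$$ which defines $P,\Gamma,f_0$, the torsion $T$, the pseudo-Weyl tensor $W$ and the pseudo-Cotton tensor $C$; moreover $(f_0)_{\mu\sigma}=P_{\mu\sigma}-P_{\sigma\mu}$ and $T^\rho{}_{\mu\sigma}=\Gamma^\rho{}_{\mu\sigma}-\Gamma^\rho{}_{\sigma\mu}$.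 Let $z:U\to(0,\infty)$ be smooth. Let $\varpi^W$ be the gauge transform of $\varpi$ by the matrix $\mathrm{diag}(z,1,z^{-1})$, and for every object $X$ built above from $\varpi$ let $X^W$ be the same object built from $\varpi^W$; in particular $\varpi_0^W=(\varpi^W)^{u_1^Wu_0^W}$ and $\Omega_0^W=(\Omega^W)^{u_1^Wu_0^W}$, where the curvature $\Omega^W$ of $\varpi^W$ is the gauge transform of $\Omega$ by $\mathrm{diag}(z,1,z^{-1})$ (part of the claim). Put $\zeta_\mu=z^{-1}\partial_\mu z$, $\zeta^\rho=g^{\rho\lambda}\zeta_\lambda$, $|\zeta|^2=\zeta_\lambda\zeta^\lambda$, $\nabla_\mu\zeta_\nu=\partial_\mu\zeta_\nu-\zeta_\lambda\Gamma^\lambda{}_{\mu\nu}$ and $$\bar W=\begin{pmatrix}z&z\zeta_\nu&\frac12z^{-1}|\zeta|^2\\0&z\,\delta^\rho_\nu&z^{-1}\zeta^\rho\\0&0&z^{-1}\end{pmatrix}.$$ Then the following hold on $U$. 1. $\varpi_0^W=\bar W^{-1}\varpi_0\bar W+\bar W^{-1}d\bar W$ and $\Omega_0^W=\bar W^{-1}\Omega_0\bar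 W$. 2. (No normality is assumed.) $$g^W_{\mu\nu}=z^2g_{\mu\nu},\qquad (\Gamma^\rho{}_{\mu\nu})^W=\Gamma^\rho{}_{\mu\nu}+\delta^\rho_\nu\zeta_\mu+\delta^\rho_\mu\zeta_\nu-g^{\rho\lambda}\zeta_\lambda g_{\mu\nu},$$ $$P_{\mu\nu}^W=P_{\mu\nu}+\nabla_\mu\zeta_\nu-\zeta_\mu\zeta_\nu+\tfrac12|\zeta|^2g_{\mu\nu},$$ $$(f_0)^W_{\mu\sigma}=(f_0)_{\mu\sigma}-\zeta_\lambda T^\lambda{}_{\mu\sigma}\quad\text{with}\quad (f_0)^W_{\mu\sigma}=P^W_{\mu\sigma}-P^W_{\sigma\mu},\qquad (T^\rho{}_{\mu\sigma})^W=T^\rho{}_{\mu\sigma},$$ $$(W^\rho{}_{\nu,\mu\sigma})^W=W^\rho{}_{\nu,\mu\sigma}+T^\rho{}_{\mu\sigma}\zeta_\nu-g^{\rho\lambda}\zeta_\lambda T^\alpha{}_{\mu\sigma}g_{\alpha\nu},$$ $$C_{\nu,\mu\sigma}^W=C_{\nu,\mu\sigma}-\zeta_\lambda W^\lambda{}_{\nu,\mu\sigma}+\zeta_\nu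 (f_0)_{\mu\sigma}+\tfrac12|\zeta|^2\,T^\alpha{}_{\mu\sigma}g_{\alpha\nu}-\zeta_\lambda T^\lambda{}_{\mu\sigma}\zeta_\nu.$$ As matrices, $\varpi_0^W$ and $\Omega_0^W$ are the block matrices displayed above with these transformed entries; explicitly their $(2,1)$ entries are $\delta^\rho_\mu$ and $T^\rho{}_{\mu\sigma}$, their $(3,2)$ entries $z^2g_{\mu\nu}$ and $z^2T^\alpha{}_{\mu\sigma}g_{\alpha\nu}$, and their $(2,3)$ entries $z^{-2}g^{\rho\lambda}P^W_{\mu\lambda}$ and $z^{-2}g^{\rho\lambda}C^W_{\lambda,\mu\sigma}$. 3. (Normal case.) Let $F$ and $\Theta$ be the $(2,2)$ and $(2,1)$ entries of $\Omega$, and suppose that $\varpi$ is normal: $\Theta=0$ and $F^a{}_{b,ac}=0$, where $F^a{}_{b,cd}=F^a{}_{b,\mu\sigma}(e^{-1})^\mu{}_c(e^{-1})^\sigma{}_d$. Then $T=T^W=0$, $W^\rho{}_{\nu,\rho\sigma}=(W^\rho{}_{\nu,\rho\sigma})^W=0$ and $f_0=f_0^W=0$. Moreover $\Gamma$ is the Levi-Civita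 connection of $g$ and $P_{\mu\nu}=\frac{-1}{m-2}\big(R_{\mu\nu}-\frac{R}{2(m-1)}g_{\mu\nu}\big)$ is its Schouten tensor (with $R_{\nu\sigma}=R^\rho{}_{\nu\rho\sigma}$ its Ricci tensor and $R$ its scalar curvature), and likewise $\Gamma^W$ and $P^W$ are the Levi-Civita connection and the Schouten tensor of $g^W=z^2g$. Finally, $$(W^\rho{}_{\nu,\mu\sigma})^W=W^\rho{}_{\nu,\mu\sigma},\qquad C_{\nu,\mu\sigma}^W=C_{\nu,\mu\sigma}-\zeta_\lambda W^\lambda{}_{\nu,\mu\sigma},$$ $$\Omega_0^W=\tfrac12\begin{pmatrix}0&C_{\nu,\mu\sigma}-\zeta_\lambda W^\lambda{}_{\nu,\mu\sigma}&0\\0&W^\rho{}_{\nu,\mu\sigma}&z^{-2}g^{\rho\kappa}(C_{\kappa,\mu\sigma}-\zeta_\lambda W^\lambda{}_{\kappa,\mu\sigma})\\0&0&0\end{pmatrix}dx^\mu\wedge dx^\sigma .$$ -/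

import Mathlib

open scoped ContDiff

namespace ConformalCartan

noncomputable section

/-! ### Matrix-valued differential forms on a coordinate domain of dimension `m` -/

/-- Coordinates `x = (x^μ)` on a chart domain of an `m`-dimensional manifold. -/
abbrev Coord (m : ℕ) := Fin m → ℝ

/-- The index set of `(1 + m + 1) × (1 + m + 1)` block matrices. -/
abbrev Idx (m : ℕ) := Unit ⊕ (Fin m ⊕ Unit)

/-- The first block index. -/
abbrev top {m : ℕ} : Idx m := Sum.inl ()
/-- The indices of the middle block. -/
abbrev mid {m : ℕ} (a : Fin m) : Idx m := Sum.inr (Sum.inl a)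
/-- The last block index. -/
abbrev bot {m : ℕ} : Idx m := Sum.inr (Sum.inr ())

/-- The block matrix
`[[a, r, b], [c, M, d], [k, s, l]]` with scalars `a b k l`, rows `r s`, columns `c d` and an
`m × m` matrix `M`. -/
def block3 {m : ℕ} (a : ℝ) (r : Fin m → ℝ) (b : ℝ)
    (c : Fin m → ℝ) (M : Matrix (Fin m) (Fin m) ℝ) (d : Fin m → ℝ)
    (k : ℝ) (s : Fin m → ℝ) (l : ℝ) : Matrix (Idx m) (Idx m) ℝ :=
  Matrix.of fun i j =>
    match i, j with
    | Sum.inl _, Sum.inl _ => a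
    | Sum.inl _, Sum.inr (Sum.inl ν) => r ν
    | Sum.inl _, Sum.inr (Sum.inr _) => b
    | Sum.inr (Sum.inl ρ), Sum.inl _ => c ρ
    | Sum.inr (Sum.inl ρ), Sum.inr (Sum.inl ν) => M ρ ν
    | Sum.inr (Sum.inl ρ), Sum.inr (Sum.inr _) => d ρ
    | Sum.inr (Sum.inr _), Sum.inl _ => k
    | Sum.inr (Sum.inr _), Sum.inr (Sum.inl ν) => s ν
    | Sum.inr (Sum.inr _), Sum.inr (Sum.inr _) => l

/-- A matrix-valued 1-form `ϖ = ϖ_μ dx^μ`, given by its coefficients `ϖ x μ = ϖ_μ(x)`. -/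
abbrev Form1 (m : ℕ) (I : Type*) := Coord m → Fin m → Matrix I I ℝ

/-- A matrix-valued 2-form `Ω = ½ Ω_{μσ} dx^μ ∧ dx^σ`, given by its antisymmetric coefficients
`Ω x μ σ = Ω_{μσ}(x)`. -/
abbrev Form2 (m : ℕ) (I : Type*) := Coord m → Fin m → Fin m → Matrix I I ℝ

/-- The partial derivative `∂_μ f` at `x`. -/
def pd {m : ℕ} (μ : Fin m) (f : Coord m → ℝ) (x : Coord m) : ℝ :=
  fderiv ℝ f x (Pi.single μ 1)

/-- The entrywise partial derivative `∂_μ M` of a matrix-valued function. -/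
def matPd {m : ℕ} {I J : Type*} (μ : Fin m) (M : Coord m → Matrix I J ℝ) (x : Coord m) :
    Matrix I J ℝ :=
  Matrix.of fun i j => pd μ (fun y => M y i j) x

/-- The curvature `dϖ + ϖ ∧ ϖ`, with coefficients
`∂_μ ϖ_σ - ∂_σ ϖ_μ + ϖ_μ ϖ_σ - ϖ_σ ϖ_μ`. -/
def curvature {m : ℕ} {I : Type*} [Fintype I] (ϖ : Form1 m I) : Form2 m I :=
  fun x μ σ =>
    matPd μ (fun y => ϖ y σ) x - matPd σ (fun y => ϖ y μ) x + ϖ x μ * ϖ x σ - ϖ x σ * ϖ x μ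

/-- `ϖ^u = u⁻¹ ϖ u + u⁻¹ du`. -/
def gauge1 {m : ℕ} {I : Type*} [Fintype I] [DecidableEq I]
    (ϖ : Form1 m I) (u : Coord m → Matrix I I ℝ) : Form1 m I :=
  fun x μ => (u x)⁻¹ * ϖ x μ * u x + (u x)⁻¹ * matPd μ u x

/-- `Ω^u = u⁻¹ Ω u`. -/
def gauge2 {m : ℕ} {I : Type*} [Fintype I] [DecidableEq I]
    (Ω : Form2 m I) (u : Coord m → Matrix I I ℝ) : Form2 m I :=
  fun x μ σ => (u x)⁻¹ * Ω x μ σ * u x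

/-! ### Conformal Cartan connections -/

/-- The Minkowski metric `η = diag(1, -1, …, -1)`. -/
def eta (m : ℕ) : Matrix (Fin m) (Fin m) ℝ :=
  Matrix.diagonal fun a => if (a : ℕ) = 0 then 1 else -1

/-- The bilinear form `Σ` of signature `(2, m)`. -/
def sigmaForm (m : ℕ) : Matrix (Idx m) (Idx m) ℝ :=
  block3 0 0 (-1) 0 (eta m) 0 (-1) 0 0

/-- The Lie algebra `𝔤` of `O(2, m)`: matrices `M` with `Mᵀ Σ = Σ (-M)`. -/
abbrev conformalLie (m : ℕ) : Submodule ℝ (Matrix (Idx m) (Idx m) ℝ) :=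
  skewAdjointMatricesSubmodule (sigmaForm m)

/-- The `η`-transpose `r^t = (r η⁻¹)ᵀ` of a row vector. -/
def etaT {m : ℕ} (r : Fin m → ℝ) : Fin m → ℝ := Matrix.vecMul r (eta m)⁻¹

theorem eta_mul_eta (m : ℕ) : eta m * eta m = 1 := by
  rw [eta, Matrix.diagonal_mul_diagonal, ← Matrix.diagonal_one]
  congr 1
  funext a
  split_ifs <;> norm_num

theorem eta_inv (m : ℕ) : (eta m)⁻¹ = eta m := Matrix.inv_eq_left_inv (eta_mul_eta m)

/-- The elements of `𝔤` are the matrices `[[ε, ι, 0], [τ, v, ι^t], [0, τ^t, -ε]]` with `v` in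
`𝔰𝔬(1, m-1)` and `τ^t = (η τ)ᵀ`. -/
theorem mem_conformalLie_iff {m : ℕ} (M : Matrix (Idx m) (Idx m) ℝ) :
    M ∈ conformalLie m ↔
      ∃ (ε : ℝ) (ι τ : Fin m → ℝ) (v : Matrix (Fin m) (Fin m) ℝ),
        v.transpose * eta m + eta m * v = 0 ∧
        M = block3 ε ι 0 τ v (etaT ι) 0 (Matrix.mulVec (eta m) τ) (-ε) := by
  have key : M ∈ conformalLie m ↔
      ∀ i j, (M.transpose * sigmaForm m) i j = (sigmaForm m * -M) i j := by
    rw [mem_skewAdjointMatricesSubmodule]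
    exact ⟨fun h i j => congrFun (congrFun h i) j, fun h => Matrix.ext h⟩
  have hι : ∀ (r : Fin m → ℝ) a, etaT r a = r a * (if (a : ℕ) = 0 then 1 else -1) := by
    intro r a
    rw [etaT, eta_inv, eta, Matrix.vecMul_diagonal]
  have hτ : ∀ (c : Fin m → ℝ) a,
      Matrix.mulVec (Matrix.diagonal fun a : Fin m => if (a : ℕ) = 0 then (1 : ℝ) else -1) c a
        = (if (a : ℕ) = 0 then 1 else -1) * c a := by
    intro c a
    rw [Matrix.mulVec_diagonal]
  have hv : ∀ v : Matrix (Fin m) (Fin m) ℝ, v.transpose * eta m + eta m * v = 0 ↔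
      ∀ a b, v b a * (if (b : ℕ) = 0 then 1 else -1)
        + (if (a : ℕ) = 0 then 1 else -1) * v a b = 0 := by
    intro v
    rw [← Matrix.ext_iff]
    simp only [eta, Matrix.add_apply, Matrix.mul_diagonal, Matrix.diagonal_mul,
      Matrix.transpose_apply, Matrix.zero_apply]
  rw [key]
  simp only [hv]
  simp only [Sum.forall, Matrix.mul_apply, Fintype.sum_sum_type, sigmaForm, block3,
    Matrix.of_apply, Matrix.transpose_apply, Finset.univ_unique, Finset.sum_singleton,
    Pi.zero_apply, eta, Matrix.diagonal_apply, Matrix.neg_apply, PUnit.default_eq_unit,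
    mul_ite, ite_mul, mul_zero, zero_mul, Finset.sum_ite_eq, Finset.sum_ite_eq',
    Finset.mem_univ, if_true, Finset.sum_const_zero, add_zero, zero_add]
  constructor
  · rintro ⟨h1, h2, h3⟩
    have g1 := (h1 ()).1 ()
    have g2 := (h1 ()).2.1
    have g3 := (h1 ()).2.2 ()
    have g6 := fun a => (h2 a).2.2 ()
    have g9 := (h3 ()).2.2 ()
    refine ⟨M top top, fun ν => M top (mid ν), fun ρ => M (mid ρ) top,
      fun ρ ν => M (mid ρ) (mid ν), fun a b => ?_, ?_⟩
    · have := (h2 a).2.1 b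
      split_ifs at this ⊢ <;> linarith
    · ext i j
      rcases i with ⟨⟩ | i | ⟨⟩ <;> rcases j with ⟨⟩ | j | ⟨⟩ <;>
        simp only [Matrix.of_apply]
      · linarith
      · rw [hι]
        have := g6 i
        split_ifs at this ⊢ <;> linarith
      · linarith
      · rw [hτ]
        have := g2 j
        split_ifs at this ⊢ <;> linarith
      · linarith
  · rintro ⟨ε, ι, τ, v, h, rfl⟩
    simp only [Matrix.of_apply, hι, hτ]
    refine ⟨fun _ => ⟨fun _ => ?_, fun a => ?_, fun _ => ?_⟩,
      fun a => ⟨fun _ => ?_, fun b => ?_, fun _ => ?_⟩,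
      fun _ => ⟨fun _ => ?_, fun a => ?_, fun _ => ?_⟩⟩
    · simp
    · split_ifs <;> ring
    · ring
    · split_ifs <;> ring
    · have := h a b
      split_ifs at this ⊢ <;> linarith
    · split_ifs <;> ring
    · ring
    · split_ifs <;> ring
    · simp

/-- The coefficients `a_μ` of the `(1,1)` entry of `ϖ`. -/
def aCoef {m : ℕ} (ϖ : Form1 m (Idx m)) (x : Coord m) : Fin m → ℝ :=
  fun μ => ϖ x μ top top

/-- The vielbein `e^a_μ`, i.e. the coefficients of the soldering form `θ^a = e^a_μ dx^μ`, the
`(2,1)` entry of `ϖ`. -/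
def vielbein {m : ℕ} (ϖ : Form1 m (Idx m)) (x : Coord m) : Matrix (Fin m) (Fin m) ℝ :=
  Matrix.of fun a μ => ϖ x μ (mid a) top

/-- A (smooth) local conformal Cartan connection on `U`: a smooth `𝔤`-valued 1-form whose
soldering form is an isomorphism at each point. -/
structure IsCartanConnection {m : ℕ} (U : Set (Coord m)) (ϖ : Form1 m (Idx m)) : Prop where
  smooth : ∀ μ i j, ContDiffOn ℝ ∞ (fun x => ϖ x μ i j) U
  mem_lie : ∀ x ∈ U, ∀ μ, ϖ x μ ∈ conformalLie m
  soldering : ∀ x ∈ U, IsUnit (vielbein ϖ x)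

/-- Normality: the torsion `Θ` (the `(2,1)` entry of the curvature) vanishes, and so does the Ricci
contraction `F^a_{b,ac}` of the `(2,2)` entry `F` of the curvature, whose form indices are referred
to the frame `θ`: `F^a_{b,cd} = F^a_{b,μσ} (e⁻¹)^μ_c (e⁻¹)^σ_d`. -/
structure IsNormal {m : ℕ} (U : Set (Coord m)) (ϖ : Form1 m (Idx m)) : Prop where
  torsion : ∀ x ∈ U, ∀ μ σ a, curvature ϖ x μ σ (mid a) top = 0
  ricci : ∀ x ∈ U, ∀ b c,
    ∑ a, ∑ μ, ∑ σ, curvature ϖ x μ σ (mid a) (mid b) *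
      (vielbein ϖ x)⁻¹ μ a * (vielbein ϖ x)⁻¹ σ c = 0

/-! ### The dressing fields and the composite fields -/

/-- The covector `q = a · e⁻¹`, `q_b = a_μ (e⁻¹)^μ_b`. -/
def qField {m : ℕ} (ϖ : Form1 m (Idx m)) (x : Coord m) : Fin m → ℝ :=
  Matrix.vecMul (aCoef ϖ x) (vielbein ϖ x)⁻¹

/-- The first dressing field `u₁`, valued in the inversions `K₁`. -/
def u1 {m : ℕ} (ϖ : Form1 m (Idx m)) (x : Coord m) : Matrix (Idx m) (Idx m) ℝ :=
  block3 1 (qField ϖ x) (1 / 2 * (qField ϖ x ⬝ᵥ etaT (qField ϖ x)))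
    0 1 (etaT (qField ϖ x))
    0 0 1

/-- The second dressing field `u₀ = diag(1, e, 1)`. -/
def u0 {m : ℕ} (ϖ : Form1 m (Idx m)) (x : Coord m) : Matrix (Idx m) (Idx m) ℝ :=
  block3 1 0 0 0 (vielbein ϖ x) 0 0 0 1

/-- The composite field `ϖ₀ = ϖ^{u₁u₀}`. -/
def varpi0 {m : ℕ} (ϖ : Form1 m (Idx m)) : Form1 m (Idx m) :=
  gauge1 ϖ fun x => u1 ϖ x * u0 ϖ x

/-- The composite field `Ω₀ = Ω^{u₁u₀}`, with `Ω` the curvature of `ϖ`. -/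
def Omega0 {m : ℕ} (ϖ : Form1 m (Idx m)) : Form2 m (Idx m) :=
  gauge2 (curvature ϖ) fun x => u1 ϖ x * u0 ϖ x

/-- The metric `g = eᵀ η e` induced by the Cartan connection. -/
def metric {m : ℕ} (ϖ : Form1 m (Idx m)) (x : Coord m) : Matrix (Fin m) (Fin m) ℝ :=
  (vielbein ϖ x).transpose * eta m * vielbein ϖ x

/-- `Γ^ρ_{μν}`: the linear connection, the `(2,2)` entry of `ϖ₀`; `μ` is the form index. -/
def Gam {m : ℕ} (ϖ : Form1 m (Idx m)) (x : Coord m) (ρ μ ν : Fin m) : ℝ :=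
  varpi0 ϖ x μ (mid ρ) (mid ν)

/-- `P_{μν}`: the `(1,2)` entry of `ϖ₀`; `μ` is the form index. -/
def Pten {m : ℕ} (ϖ : Form1 m (Idx m)) (x : Coord m) (μ ν : Fin m) : ℝ :=
  varpi0 ϖ x μ top (mid ν)

/-- `(f₀)_{μσ}`: the `(1,1)` entry of `Ω₀`. -/
def f0 {m : ℕ} (ϖ : Form1 m (Idx m)) (x : Coord m) (μ σ : Fin m) : ℝ :=
  Omega0 ϖ x μ σ top top

/-- `T^ρ_{μσ}`: the torsion, the `(2,1)` entry of `Ω₀`. -/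
def Tor {m : ℕ} (ϖ : Form1 m (Idx m)) (x : Coord m) (ρ μ σ : Fin m) : ℝ :=
  Omega0 ϖ x μ σ (mid ρ) top

/-- `W^ρ_{ν,μσ}`: the (pseudo-)Weyl tensor, the `(2,2)` entry of `Ω₀`. -/
def Wten {m : ℕ} (ϖ : Form1 m (Idx m)) (x : Coord m) (ρ ν μ σ : Fin m) : ℝ :=
  Omega0 ϖ x μ σ (mid ρ) (mid ν)

/-- `C_{ν,μσ}`: the (pseudo-)Cotton tensor, the `(1,2)` entry of `Ω₀`. -/
def Cten {m : ℕ} (ϖ : Form1 m (Idx m)) (x : Coord m) (ν μ σ : Fin m) : ℝ :=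
  Omega0 ϖ x μ σ top (mid ν)

/-! ### The Weyl group -/

/-- The gauge element `W = diag(z, 1, z⁻¹)`. -/
def weylMat {m : ℕ} (z : Coord m → ℝ) (x : Coord m) : Matrix (Idx m) (Idx m) ℝ :=
  block3 (z x) 0 0 0 1 0 0 0 (z x)⁻¹

/-- The Weyl gauge transform `ϖ^W = W⁻¹ ϖ W + W⁻¹ dW` of a Cartan connection. The dressing fields,
the composite fields and the tensors above are built from the Cartan connection, so that their Weyl
transforms are obtained by evaluating them at `weylAct z ϖ`; for instance
`varpi0 (weylAct z ϖ) = (ϖ^W)^{u₁^W u₀^W}`. -/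
def weylAct {m : ℕ} (z : Coord m → ℝ) (ϖ : Form1 m (Idx m)) : Form1 m (Idx m) :=
  gauge1 ϖ (weylMat z)

/-- `ζ_μ = z⁻¹ ∂_μ z`. -/
def zeta {m : ℕ} (z : Coord m → ℝ) (x : Coord m) (μ : Fin m) : ℝ := (z x)⁻¹ * pd μ z x

/-- `|ζ|² = ζ_λ g^{λα} ζ_α`. -/
def zetaSq {m : ℕ} (z : Coord m → ℝ) (ϖ : Form1 m (Idx m)) (x : Coord m) : ℝ :=
  ∑ l, ∑ α, zeta z x l * (metric ϖ x)⁻¹ l α * zeta z x α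

/-- `ζ^ρ = g^{ρλ} ζ_λ`. -/
def zetaUp {m : ℕ} (z : Coord m → ℝ) (ϖ : Form1 m (Idx m)) (x : Coord m) (ρ : Fin m) : ℝ :=
  ∑ l, (metric ϖ x)⁻¹ ρ l * zeta z x l

/-- `∇_μ ζ_ν = ∂_μ ζ_ν - ζ_λ Γ^λ_{μν}`. -/
def nablaZeta {m : ℕ} (z : Coord m → ℝ) (ϖ : Form1 m (Idx m)) (x : Coord m) (μ ν : Fin m) : ℝ :=
  pd μ (fun y => zeta z y ν) x - ∑ l, zeta z x l * Gam ϖ x l μ ν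

/-- The `z`-dependent matrix `W̄`. -/
def Wbar {m : ℕ} (z : Coord m → ℝ) (ϖ : Form1 m (Idx m)) (x : Coord m) :
    Matrix (Idx m) (Idx m) ℝ :=
  block3 (z x) (fun ν => z x * zeta z x ν) (1 / 2 * (z x)⁻¹ * zetaSq z ϖ x)
    0 (z x • (1 : Matrix (Fin m) (Fin m) ℝ)) (fun ρ => (z x)⁻¹ * zetaUp z ϖ x ρ)
    0 0 (z x)⁻¹

/-! ### Tensors of a pseudo-Riemannian metric -/

/-- The Levi-Civita connection `½ g^{ρλ} (∂_μ g_{λν} + ∂_ν g_{λμ} - ∂_λ g_{μν})`. -/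
def christoffel {m : ℕ} (g : Coord m → Matrix (Fin m) (Fin m) ℝ) (x : Coord m)
    (ρ μ ν : Fin m) : ℝ :=
  1 / 2 * ∑ l, (g x)⁻¹ ρ l *
    (pd μ (fun y => g y l ν) x + pd ν (fun y => g y l μ) x - pd l (fun y => g y μ ν) x)

/-- The Ricci tensor `R_{νσ} = R^ρ_{ν,ρσ}` of the Levi-Civita connection. -/
def ricci {m : ℕ} (g : Coord m → Matrix (Fin m) (Fin m) ℝ) (x : Coord m) (ν σ : Fin m) : ℝ :=
  ∑ ρ, curvature (fun y μ => Matrix.of fun ρ' ν' => christoffel g y ρ' μ ν') x ρ σ ρ ν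

/-- The scalar curvature `g^{νσ} R_{νσ}`. -/
def scalarCurv {m : ℕ} (g : Coord m → Matrix (Fin m) (Fin m) ℝ) (x : Coord m) : ℝ :=
  ∑ ν, ∑ σ, (g x)⁻¹ ν σ * ricci g x ν σ

/-- The Schouten tensor `-1/(m-2) (R_{μν} - R/(2(m-1)) g_{μν})`. -/
def schouten {m : ℕ} (g : Coord m → Matrix (Fin m) (Fin m) ℝ) (x : Coord m) (μ ν : Fin m) : ℝ :=
  -1 / ((m : ℝ) - 2) * (ricci g x μ ν - scalarCurv g x / (2 * ((m : ℝ) - 1)) * g x μ ν)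

end

end ConformalCartan

open ConformalCartan

/-! Write `u = u₁u₀` for the dressing and `W` for the Weyl element. Everything rests on the identity
`W u^W = u W̄` (`weylMat_mul_dress`). As gauge transformations form a right action
(`gauge1_gauge1`), `ϖ₀^W = (ϖ^W)^{u^W} = ϖ^{W u^W} = ϖ^{u W̄} = ϖ₀^{W̄}`; covariance of the
curvature (`curvature_gauge1`) gives the same law for `Ω₀`.

The block shapes come from `uᵀ Σ u = Σ_g`, the form `Σ` with `η` replaced by `g` (`dress_form`).
Skewness of `ϖ` and `Ω` for `Σ` becomes compatibility of `ϖ₀` and `Ω₀` with `Σ_g`, which fixes the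
last row and column and makes `Γ` a metric connection (`skew_metricForm`). The first column of `ϖ₀`
is constant because that of `u` is, and `q = a e⁻¹` is exactly what removes `a`. The transformation
laws are then the blocks of `W̄ ϖ₀^W = ϖ₀ W̄ + dW̄` and `W̄ Ω₀^W = Ω₀ W̄`, so `W̄⁻¹` is never
computed.

In the normal case `Γ` is metric and torsion-free, hence Levi-Civita. Contracting the (2,2) block of
`Ω₀ = dϖ₀ + ϖ₀²` gives `Ric + (m-2) P + (tr P) g = 0`. The first Bianchi identity and `tr W = 0`
make `Ric`, hence `P`, symmetric, and a second trace determines `tr P`, so that `P` is the Schouten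
tensor. Normality is Weyl invariant, so the same result applies to `ϖ^W`. -/

namespace ConformalCartan

/-! ### Calculus of matrix-valued functions -/

/-- Entrywise smoothness on `U` of a matrix-valued function. -/
def SmoothMat {m : ℕ} {I J : Type*} (U : Set (Coord m)) (M : Coord m → Matrix I J ℝ) : Prop :=
  ∀ i j, ContDiffOn ℝ ∞ (fun x => M x i j) U

/-- Entrywise differentiability at `x` of a matrix-valued function. -/
def DiffMatAt {m : ℕ} {I J : Type*} (M : Coord m → Matrix I J ℝ) (x : Coord m) : Prop :=
  ∀ i j, DifferentiableAt ℝ (fun y => M y i j) x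

section Calculus

variable {m : ℕ} {I J K : Type*} {U : Set (Coord m)} {x : Coord m}

theorem ContDiffOn.diffAt (hU : IsOpen U) {f : Coord m → ℝ} (hf : ContDiffOn ℝ ∞ f U)
    (hx : x ∈ U) : DifferentiableAt ℝ f x :=
  (hf.contDiffAt (hU.mem_nhds hx)).differentiableAt (by simp)

theorem SmoothMat.diffMatAt (hU : IsOpen U) {M : Coord m → Matrix I J ℝ} (hM : SmoothMat U M)
    (hx : x ∈ U) : DiffMatAt M x :=
  fun i j => ContDiffOn.diffAt hU (hM i j) hx

theorem pd_congr (hU : IsOpen U) {f g : Coord m → ℝ} (h : ∀ y ∈ U, f y = g y) (hx : x ∈ U)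
    (μ : Fin m) : pd μ f x = pd μ g x := by
  have : f =ᶠ[nhds x] g := Filter.eventually_of_mem (hU.mem_nhds hx) h
  rw [pd, pd, this.fderiv_eq]

@[simp] theorem pd_const (μ : Fin m) (c : ℝ) : pd μ (fun _ => c) x = 0 := by
  simp [pd]

theorem pd_add {f g : Coord m → ℝ} (hf : DifferentiableAt ℝ f x) (hg : DifferentiableAt ℝ g x)
    (μ : Fin m) : pd μ (fun y => f y + g y) x = pd μ f x + pd μ g x := by
  simp only [pd]
  rw [fderiv_fun_add hf hg]
  rfl

theorem pd_mul {f g : Coord m → ℝ} (hf : DifferentiableAt ℝ f x) (hg : DifferentiableAt ℝ g x)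
    (μ : Fin m) : pd μ (fun y => f y * g y) x = pd μ f x * g x + f x * pd μ g x := by
  simp only [pd]
  rw [fderiv_fun_mul hf hg]
  simp
  ring

theorem pd_sum {ι : Type*} (s : Finset ι) {f : ι → Coord m → ℝ}
    (hf : ∀ i, DifferentiableAt ℝ (f i) x) (μ : Fin m) :
    pd μ (fun y => ∑ i ∈ s, f i y) x = ∑ i ∈ s, pd μ (f i) x := by
  simp only [pd]
  rw [fderiv_fun_sum fun i _ => hf i]
  simp

theorem contDiffOn_pd (hU : IsOpen U) {f : Coord m → ℝ} (hf : ContDiffOn ℝ ∞ f U) (μ : Fin m) :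
    ContDiffOn ℝ ∞ (pd μ f) U :=
  (hf.fderiv_of_isOpen hU (by simp)).clm_apply contDiffOn_const

theorem pd_pd_comm (hU : IsOpen U) {f : Coord m → ℝ} (hf : ContDiffOn ℝ ∞ f U) (hx : x ∈ U)
    (μ σ : Fin m) : pd μ (pd σ f) x = pd σ (pd μ f) x := by
  have hfx := hf.contDiffAt (hU.mem_nhds hx)
  have hsymm : IsSymmSndFDerivAt ℝ f x := hfx.isSymmSndFDerivAt (by
    rw [minSmoothness_of_isRCLikeNormedField]
    exact WithTop.coe_le_coe.2 (le_top (a := (2 : ℕ∞))))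
  have hd : DifferentiableAt ℝ (fderiv ℝ f) x :=
    (hfx.fderiv_right (m := ∞) (by simp)).differentiableAt (by simp)
  have key : ∀ α β : Fin m, pd α (pd β f) x
      = fderiv ℝ (fderiv ℝ f) x (Pi.single α 1) (Pi.single β 1) := by
    intro α β
    change fderiv ℝ (fun y => fderiv ℝ f y (Pi.single β 1)) x (Pi.single α 1) = _
    rw [fderiv_clm_apply hd (differentiableAt_const _)]
    simp
  rw [key, key]
  exact hsymm.eq _ _

theorem matPd_congr (hU : IsOpen U) {M N : Coord m → Matrix I J ℝ} (h : ∀ y ∈ U, M y = N y)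
    (hx : x ∈ U) (μ : Fin m) : matPd μ M x = matPd μ N x := by
  ext i j
  exact pd_congr hU (fun y hy => by rw [h y hy]) hx μ

@[simp] theorem matPd_const (μ : Fin m) (S : Matrix I J ℝ) : matPd μ (fun _ => S) x = 0 := by
  ext i j
  simp [matPd]

theorem matPd_transpose (μ : Fin m) (M : Coord m → Matrix I J ℝ) :
    matPd μ (fun y => (M y).transpose) x = (matPd μ M x).transpose := rfl

theorem matPd_add {M N : Coord m → Matrix I J ℝ} (hM : DiffMatAt M x) (hN : DiffMatAt N x)
    (μ : Fin m) : matPd μ (fun y => M y + N y) x = matPd μ M x + matPd μ N x := by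
  ext i j
  exact pd_add (hM i j) (hN i j) μ

theorem matPd_mul [Fintype J] {M : Coord m → Matrix I J ℝ} {N : Coord m → Matrix J K ℝ}
    (hM : DiffMatAt M x) (hN : DiffMatAt N x) (μ : Fin m) :
    matPd μ (fun y => M y * N y) x = matPd μ M x * N x + M x * matPd μ N x := by
  ext i k
  simp only [matPd, Matrix.of_apply, Matrix.mul_apply, Matrix.add_apply]
  rw [pd_sum _ fun j => (hM i j).fun_mul (hN j k), ← Finset.sum_add_distrib]
  exact Finset.sum_congr rfl fun j _ => pd_mul (hM i j) (hN j k) μ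

theorem DiffMatAt.mul [Fintype J] {M : Coord m → Matrix I J ℝ} {N : Coord m → Matrix J K ℝ}
    (hM : DiffMatAt M x) (hN : DiffMatAt N x) : DiffMatAt (fun y => M y * N y) x := by
  intro i k
  simp only [Matrix.mul_apply]
  exact DifferentiableAt.fun_sum fun j _ => (hM i j).mul (hN j k)

theorem DiffMatAt.transpose {M : Coord m → Matrix I J ℝ} (hM : DiffMatAt M x) :
    DiffMatAt (fun y => (M y).transpose) x := fun i j => hM j i

theorem diffMatAt_const (S : Matrix I J ℝ) : DiffMatAt (fun _ : Coord m => S) x :=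
  fun _ _ => differentiableAt_const _

theorem smoothMat_const (S : Matrix I J ℝ) : SmoothMat U (fun _ => S) :=
  fun _ _ => contDiffOn_const

theorem SmoothMat.add {M N : Coord m → Matrix I J ℝ} (hM : SmoothMat U M) (hN : SmoothMat U N) :
    SmoothMat U (fun x => M x + N x) := fun i j => (hM i j).add (hN i j)

theorem SmoothMat.transpose {M : Coord m → Matrix I J ℝ} (hM : SmoothMat U M) :
    SmoothMat U (fun x => (M x).transpose) := fun i j => hM j i

theorem SmoothMat.mul [Fintype J] {M : Coord m → Matrix I J ℝ} {N : Coord m → Matrix J K ℝ}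
    (hM : SmoothMat U M) (hN : SmoothMat U N) : SmoothMat U (fun x => M x * N x) := by
  intro i k
  simp only [Matrix.mul_apply]
  exact ContDiffOn.sum fun j _ => (hM i j).mul (hN j k)

theorem SmoothMat.matPd (hU : IsOpen U) {M : Coord m → Matrix I J ℝ} (hM : SmoothMat U M)
    (μ : Fin m) : SmoothMat U (matPd μ M) := fun i j => contDiffOn_pd hU (hM i j) μ

theorem SmoothMat.det [Fintype I] [DecidableEq I] {M : Coord m → Matrix I I ℝ}
    (hM : SmoothMat U M) : ContDiffOn ℝ ∞ (fun x => (M x).det) U := by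
  simp only [Matrix.det_apply']
  exact ContDiffOn.sum fun σ _ => contDiffOn_const.mul (contDiffOn_prod fun i _ => hM _ _)

theorem SmoothMat.inv [Fintype I] [DecidableEq I] {M : Coord m → Matrix I I ℝ}
    (hM : SmoothMat U M) (hu : ∀ x ∈ U, IsUnit (M x)) : SmoothMat U (fun x => (M x)⁻¹) := by
  intro i j
  -- Cramer's rule: an entry of the adjugate is the determinant of the matrix with one row replaced
  -- by a constant one.
  simp only [Matrix.inv_def, Ring.inverse_eq_inv', Matrix.smul_apply, smul_eq_mul,
    Matrix.adjugate_apply]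
  refine (hM.det.inv fun x hx => ((Matrix.isUnit_iff_isUnit_det _).1 (hu x hx)).ne_zero).mul ?_
  refine SmoothMat.det fun k l => ?_
  by_cases h : k = j
  · subst h
    simp only [Matrix.updateRow_self]
    exact contDiffOn_const
  · simp only [Matrix.updateRow_ne h]
    exact hM k l

theorem isUnit_det_of_isUnit [Fintype I] [DecidableEq I] {A : Matrix I I ℝ} (h : IsUnit A) :
    IsUnit A.det := (Matrix.isUnit_iff_isUnit_det _).1 h

end Calculus

/-! ### Gauge transformations -/

section Gauge

variable {m : ℕ} {I : Type*} [Fintype I] [DecidableEq I] {U : Set (Coord m)} {x : Coord m}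

/-- The inverse-free form of the gauge law. Later computations differentiate or compare blocks in
this form, so `u⁻¹` is neither expanded nor differentiated. -/
theorem mul_gauge1 (ϖ : Form1 m I) {u : Coord m → Matrix I I ℝ} (hu : IsUnit (u x)) (μ : Fin m) :
    u x * gauge1 ϖ u x μ = ϖ x μ * u x + matPd μ u x := by
  have h := isUnit_det_of_isUnit hu
  simp only [gauge1, mul_add, Matrix.mul_assoc, Matrix.mul_nonsing_inv_cancel_left _ _ h]

theorem mul_gauge2 (Ω : Form2 m I) {u : Coord m → Matrix I I ℝ} (hu : IsUnit (u x)) (μ σ : Fin m) :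
    u x * gauge2 Ω u x μ σ = Ω x μ σ * u x := by
  have h := isUnit_det_of_isUnit hu
  simp only [gauge2, Matrix.mul_assoc, Matrix.mul_nonsing_inv_cancel_left _ _ h]

/-- Gauge transformations compose as a right action, by the Leibniz rule for `d(uv)`. -/
theorem gauge1_gauge1 (ϖ : Form1 m I) {u v : Coord m → Matrix I I ℝ} (hu : IsUnit (u x))
    (hdu : DiffMatAt u x) (hdv : DiffMatAt v x) (μ : Fin m) :
    gauge1 (gauge1 ϖ u) v x μ = gauge1 ϖ (fun y => u y * v y) x μ := by
  have h := isUnit_det_of_isUnit hu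
  simp only [gauge1]
  rw [matPd_mul hdu hdv, Matrix.mul_inv_rev]
  simp only [mul_add, add_mul, Matrix.mul_assoc, Matrix.nonsing_inv_mul_cancel_left _ _ h]
  abel

theorem gauge1_congr (ϖ : Form1 m I) (hU : IsOpen U) {u v : Coord m → Matrix I I ℝ}
    (h : ∀ y ∈ U, u y = v y) (hx : x ∈ U) (μ : Fin m) :
    gauge1 ϖ u x μ = gauge1 ϖ v x μ := by
  rw [gauge1, gauge1, h x hx, matPd_congr hU h hx]

theorem gauge2_gauge2 (Ω : Form2 m I) (u v : Coord m → Matrix I I ℝ) (μ σ : Fin m) :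
    gauge2 (gauge2 Ω u) v x μ σ = gauge2 Ω (fun y => u y * v y) x μ σ := by
  simp only [gauge2, Matrix.mul_inv_rev, Matrix.mul_assoc]

theorem smoothMat_gauge1 (hU : IsOpen U) {ϖ : Form1 m I} (hϖ : ∀ μ, SmoothMat U fun x => ϖ x μ)
    {u : Coord m → Matrix I I ℝ} (hu : SmoothMat U u) (hunit : ∀ x ∈ U, IsUnit (u x)) (μ : Fin m) :
    SmoothMat U fun x => gauge1 ϖ u x μ :=
  (((hu.inv hunit).mul (hϖ μ)).mul hu).add ((hu.inv hunit).mul (hu.matPd hU μ))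

/-- The curvature of a gauge-transformed connection is the gauge transform of its curvature. -/
theorem curvature_gauge1 (hU : IsOpen U) {ϖ : Form1 m I} (hϖ : ∀ μ, SmoothMat U fun x => ϖ x μ)
    {u : Coord m → Matrix I I ℝ} (hu : SmoothMat U u) (hunit : ∀ x ∈ U, IsUnit (u x))
    (hx : x ∈ U) (μ σ : Fin m) :
    curvature (gauge1 ϖ u) x μ σ = gauge2 (curvature ϖ) u x μ σ := by
  have hdu := hu.diffMatAt hU hx
  -- Differentiates `u ϖ^u = ϖ u + du` on the open set `U`; the second derivatives of `u` cancel
  -- after antisymmetrization by `hsymm`.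
  have hd : ∀ α β : Fin m,
      matPd α u x * gauge1 ϖ u x β + u x * matPd α (fun y => gauge1 ϖ u y β) x
        = matPd α (fun y => ϖ y β) x * u x + ϖ x β * matPd α u x + matPd α (matPd β u) x := by
    intro α β
    have h1 := matPd_mul hdu ((smoothMat_gauge1 hU hϖ hu hunit β).diffMatAt hU hx) α
    have h2 := matPd_congr hU (fun y hy => mul_gauge1 ϖ (hunit y hy) β) hx α
    have h3 := matPd_add (((hϖ β).mul hu).diffMatAt hU hx) ((hu.matPd hU β).diffMatAt hU hx) α
    rw [← h1, h2, h3, matPd_mul ((hϖ β).diffMatAt hU hx) hdu]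
  have hsymm : matPd μ (matPd σ u) x = matPd σ (matPd μ u) x := by
    ext i j
    exact pd_pd_comm hU (hu i j) hx μ σ
  have hq : ∀ α β : Fin m, u x * (gauge1 ϖ u x α * gauge1 ϖ u x β)
      = ϖ x α * ϖ x β * u x + ϖ x α * matPd β u x + matPd α u x * gauge1 ϖ u x β := by
    intro α β
    rw [← Matrix.mul_assoc, mul_gauge1 ϖ (hunit x hx), add_mul, Matrix.mul_assoc,
      mul_gauge1 ϖ (hunit x hx), mul_add, Matrix.mul_assoc]
  have hmain : u x * curvature (gauge1 ϖ u) x μ σ = curvature ϖ x μ σ * u x := by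
    have e1 := hd μ σ
    have e2 := hd σ μ
    rw [← eq_sub_iff_add_eq'] at e1 e2
    simp only [curvature, mul_add, mul_sub, add_mul, sub_mul, hq, e1, e2, hsymm]
    abel
  rw [← mul_gauge2 (curvature ϖ) (hunit x hx)] at hmain
  have h := isUnit_det_of_isUnit (hunit x hx)
  rw [← Matrix.nonsing_inv_mul_cancel_left (u x) (curvature (gauge1 ϖ u) x μ σ) h, hmain,
    Matrix.nonsing_inv_mul_cancel_left _ _ h]

/-- If `ϖ` is skew-adjoint for the constant form `S`, then `ϖ^u` is a metric connection for the
form `uᵀ S u`. -/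
theorem gauge1_skew {S : Matrix I I ℝ} {ϖ : Form1 m I} {u : Coord m → Matrix I I ℝ}
    (hdu : DiffMatAt u x) (hunit : IsUnit (u x)) {μ : Fin m}
    (hS : (ϖ x μ).transpose * S + S * ϖ x μ = 0) :
    (gauge1 ϖ u x μ).transpose * ((u x).transpose * S * u x)
        + (u x).transpose * S * u x * gauge1 ϖ u x μ
      = matPd μ (fun y => (u y).transpose * S * u y) x := by
  -- Since `S` is constant, only the two factors `u` are differentiated; substituting `u ϖ^u = ϖ u +
  -- du` on the left leaves exactly these terms plus `uᵀ(ϖᵀS + Sϖ)u = 0`.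
  rw [matPd_mul (hdu.transpose.mul (diffMatAt_const S)) hdu,
    matPd_mul hdu.transpose (diffMatAt_const S), matPd_transpose, matPd_const,
    Matrix.mul_zero, add_zero, Matrix.mul_assoc (_ * S), mul_gauge1 ϖ hunit,
    ← Matrix.mul_assoc, ← Matrix.mul_assoc, ← Matrix.transpose_mul, mul_gauge1 ϖ hunit,
    Matrix.transpose_add, Matrix.transpose_mul]
  rw [← eq_neg_iff_add_eq_zero] at hS
  simp only [add_mul, mul_add, Matrix.mul_assoc]
  rw [← Matrix.mul_assoc _ S (u x), hS]
  simp only [Matrix.neg_mul, Matrix.mul_neg, Matrix.mul_assoc]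
  abel

theorem gauge2_skew {S : Matrix I I ℝ} {Ω : Form2 m I} {u : Coord m → Matrix I I ℝ}
    (hunit : IsUnit (u x)) {μ σ : Fin m}
    (hS : (Ω x μ σ).transpose * S + S * Ω x μ σ = 0) :
    (gauge2 Ω u x μ σ).transpose * ((u x).transpose * S * u x)
        + (u x).transpose * S * u x * gauge2 Ω u x μ σ = 0 := by
  rw [Matrix.mul_assoc (_ * S), mul_gauge2 Ω hunit,
    ← Matrix.mul_assoc, ← Matrix.mul_assoc, ← Matrix.transpose_mul, mul_gauge2 Ω hunit,
    Matrix.transpose_mul]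
  rw [← eq_neg_iff_add_eq_zero] at hS
  simp only [Matrix.mul_assoc]
  rw [← Matrix.mul_assoc _ S (u x), hS]
  simp only [Matrix.neg_mul, Matrix.mul_neg, Matrix.mul_assoc]
  abel

/-- The derivative terms are skew because `S` is constant, the quadratic ones because skew-adjoint
matrices are closed under commutators. -/
theorem curvature_skew (hU : IsOpen U) {S : Matrix I I ℝ} {ϖ : Form1 m I}
    (hϖ : ∀ μ, SmoothMat U fun x => ϖ x μ)
    (hS : ∀ x ∈ U, ∀ μ, (ϖ x μ).transpose * S + S * ϖ x μ = 0) (hx : x ∈ U) (μ σ : Fin m) :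
    (curvature ϖ x μ σ).transpose * S + S * curvature ϖ x μ σ = 0 := by
  have hd : ∀ α β : Fin m, (matPd α (fun y => ϖ y β) x).transpose * S
      = -(S * matPd α (fun y => ϖ y β) x) := by
    intro α β
    have h0 := (hϖ β).diffMatAt hU hx
    have h1 := matPd_congr (N := fun _ => 0) hU (fun y hy => hS y hy β) hx α
    rw [matPd_add (h0.transpose.mul (diffMatAt_const S)) ((diffMatAt_const S).mul h0),
      matPd_mul h0.transpose (diffMatAt_const S), matPd_mul (diffMatAt_const S) h0,
      matPd_transpose] at h1
    simp only [matPd_const, Matrix.mul_zero, Matrix.zero_mul, add_zero, zero_add] at h1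
    exact eq_neg_of_add_eq_zero_left h1
  have hs : ∀ α, (ϖ x α).transpose * S = -(S * ϖ x α) := fun α =>
    eq_neg_of_add_eq_zero_left (hS x hx α)
  have hq : ∀ α β : Fin m, (ϖ x β).transpose * (ϖ x α).transpose * S
      = S * (ϖ x β * ϖ x α) := by
    intro α β
    rw [Matrix.mul_assoc, hs, Matrix.mul_neg, ← Matrix.mul_assoc, hs, Matrix.neg_mul, neg_neg,
      Matrix.mul_assoc]
  simp only [curvature, Matrix.transpose_add, Matrix.transpose_sub, Matrix.transpose_mul, add_mul,
    sub_mul, mul_add, mul_sub, hd, hq]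
  abel

end Gauge

/-! ### Block matrices -/

section Block

variable {m : ℕ}

theorem block3_mul (a b k l a' b' k' l' : ℝ) (r c d s r' c' d' s' : Fin m → ℝ)
    (M M' : Matrix (Fin m) (Fin m) ℝ) :
    block3 a r b c M d k s l * block3 a' r' b' c' M' d' k' s' l' =
      block3 (a * a' + r ⬝ᵥ c' + b * k') (a • r' + Matrix.vecMul r M' + b • s')
        (a * b' + r ⬝ᵥ d' + b * l')
        (a' • c + Matrix.mulVec M c' + k' • d)
        (Matrix.vecMulVec c r' + M * M' + Matrix.vecMulVec d s')
        (b' • c + Matrix.mulVec M d' + l' • d)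
        (k * a' + s ⬝ᵥ c' + l * k') (k • r' + Matrix.vecMul s M' + l • s')
        (k * b' + s ⬝ᵥ d' + l * l') := by
  ext i j
  rcases i with ⟨⟩ | i | ⟨⟩ <;> rcases j with ⟨⟩ | j | ⟨⟩ <;>
    simp [block3, Matrix.mul_apply, Fintype.sum_sum_type, dotProduct, Matrix.vecMul,
      Matrix.mulVec, Matrix.vecMulVec_apply] <;> ring

theorem block3_add (a b k l a' b' k' l' : ℝ) (r c d s r' c' d' s' : Fin m → ℝ)
    (M M' : Matrix (Fin m) (Fin m) ℝ) :
    block3 a r b c M d k s l + block3 a' r' b' c' M' d' k' s' l' =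
      block3 (a + a') (r + r') (b + b') (c + c') (M + M') (d + d') (k + k') (s + s') (l + l') := by
  ext i j
  rcases i with ⟨⟩ | i | ⟨⟩ <;> rcases j with ⟨⟩ | j | ⟨⟩ <;> simp [block3]

theorem block3_transpose (a b k l : ℝ) (r c d s : Fin m → ℝ) (M : Matrix (Fin m) (Fin m) ℝ) :
    (block3 a r b c M d k s l).transpose = block3 a c k r M.transpose s b d l := by
  ext i j
  rcases i with ⟨⟩ | i | ⟨⟩ <;> rcases j with ⟨⟩ | j | ⟨⟩ <;> simp [block3]

theorem block3_one : (1 : Matrix (Idx m) (Idx m) ℝ) = block3 1 0 0 0 1 0 0 0 1 := by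
  ext i j
  rcases i with ⟨⟩ | i | ⟨⟩ <;> rcases j with ⟨⟩ | j | ⟨⟩ <;>
    simp [block3, Matrix.one_apply]

theorem block3_eta (M : Matrix (Idx m) (Idx m) ℝ) :
    M = block3 (M top top) (fun ν => M top (mid ν)) (M top bot)
      (fun ρ => M (mid ρ) top) (Matrix.of fun ρ ν => M (mid ρ) (mid ν)) (fun ρ => M (mid ρ) bot)
      (M bot top) (fun ν => M bot (mid ν)) (M bot bot) := by
  ext i j
  rcases i with ⟨⟩ | i | ⟨⟩ <;> rcases j with ⟨⟩ | j | ⟨⟩ <;> rfl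

theorem block3_inj {a b k l a' b' k' l' : ℝ} {r c d s r' c' d' s' : Fin m → ℝ}
    {M M' : Matrix (Fin m) (Fin m) ℝ}
    (h : block3 a r b c M d k s l = block3 a' r' b' c' M' d' k' s' l') :
    (a = a' ∧ r = r' ∧ b = b') ∧ (c = c' ∧ M = M' ∧ d = d') ∧ k = k' ∧ s = s' ∧ l = l' := by
  have h' : ∀ i j, _ := fun i j => congrFun (congrFun h i) j
  refine ⟨⟨h' top top, ?_, h' top bot⟩, ⟨?_, ?_, ?_⟩, h' bot top, ?_, h' bot bot⟩
  · exact funext fun ν => h' top (mid ν)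
  · exact funext fun ρ => h' (mid ρ) top
  · exact Matrix.ext fun ρ ν => h' (mid ρ) (mid ν)
  · exact funext fun ρ => h' (mid ρ) bot
  · exact funext fun ν => h' bot (mid ν)

theorem isUnit_block3 {a b l : ℝ} {r d : Fin m → ℝ} {M : Matrix (Fin m) (Fin m) ℝ}
    (ha : a ≠ 0) (hl : l ≠ 0) (hM : IsUnit M) : IsUnit (block3 a r b 0 M d 0 0 l) := by
  have hdet := isUnit_det_of_isUnit hM
  -- The inverse found by back substitution in the block upper triangular system; a one-sided
  -- inverse suffices for square matrices.
  refine IsUnit.of_mul_eq_one (block3 a⁻¹ (-a⁻¹ • Matrix.vecMul r M⁻¹)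
    (a⁻¹ * l⁻¹ * (r ⬝ᵥ Matrix.mulVec M⁻¹ d - b)) 0 M⁻¹ (-l⁻¹ • Matrix.mulVec M⁻¹ d) 0 0 l⁻¹) ?_
  rw [block3_mul, block3_one]
  congr 1
  · simp [ha]
  · ext; simp [ha]
  · simp; field_simp; ring
  · ext; simp
  · ext; simp [Matrix.mul_nonsing_inv _ hdet]
  · ext; simp [Matrix.mulVec_smul, Matrix.mulVec_neg, Matrix.mulVec_mulVec,
      Matrix.mul_nonsing_inv _ hdet]
  · simp
  · ext; simp
  · simp [hl]

/-- The form `Σ` with `η` replaced by a general matrix `g`. -/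
def metricForm (g : Matrix (Fin m) (Fin m) ℝ) : Matrix (Idx m) (Idx m) ℝ :=
  block3 0 0 (-1) 0 g 0 (-1) 0 0

/-- The corner blocks of `hM` give the two zeros and the opposite diagonal entries, the side blocks
give the last row and column by lowering and raising with `g`, and the middle block is the second
conjunct. It is used with `D = dg` for `ϖ₀` and with `D = 0` for `Ω₀`. -/
theorem skew_metricForm {g D : Matrix (Fin m) (Fin m) ℝ} (hu : IsUnit g)
    {M : Matrix (Idx m) (Idx m) ℝ}
    (hM : M.transpose * metricForm g + metricForm g * M = block3 0 0 0 0 D 0 0 0 0) :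
    M = block3 (M top top) (fun ν => M top (mid ν)) 0
      (fun ρ => M (mid ρ) top) (Matrix.of fun ρ ν => M (mid ρ) (mid ν))
      (fun ρ => ∑ l, g⁻¹ ρ l * M top (mid l))
      0 (fun ν => ∑ α, M (mid α) top * g α ν) (-M top top) ∧
    (Matrix.of fun ρ ν => M (mid ρ) (mid ν)).transpose * g
      + g * (Matrix.of fun ρ ν => M (mid ρ) (mid ν)) = D := by
  have hdet := isUnit_det_of_isUnit hu
  have h := hM
  rw [block3_eta M, block3_transpose, metricForm, block3_mul, block3_mul, block3_add] at h
  obtain ⟨⟨h1, h2, h3⟩, ⟨h4, h5, h6⟩, h7, h8, h9⟩ := block3_inj h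
  simp only [zero_dotProduct, dotProduct_zero, mul_zero, zero_mul, add_zero, zero_add,
    Matrix.zero_vecMul, Matrix.mulVec_zero, smul_zero,
    zero_smul, mul_neg, neg_mul, mul_one, one_mul, neg_smul, one_smul] at h1 h2 h3 h4 h5 h6 h7 h8 h9
  have k1 : M bot top = 0 := by linarith
  have k9 : M top bot = 0 := by linarith
  have k3 : M bot bot = -M top top := by linarith
  have k2 : (fun ν => M bot (mid ν)) = Matrix.vecMul (fun ρ => M (mid ρ) top) g := by
    ext ν
    have := congrFun h2 ν
    simp at this
    linarith
  have k6 : (fun ρ => M (mid ρ) bot) = Matrix.mulVec g⁻¹ (fun l => M top (mid l)) := by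
    have : Matrix.mulVec g (fun ρ => M (mid ρ) bot) = fun l => M top (mid l) := by
      ext ν
      have := congrFun h6 ν
      simp at this
      linarith
    rw [← this, Matrix.mulVec_mulVec, Matrix.nonsing_inv_mul _ hdet, Matrix.one_mulVec]
  refine ⟨?_, ?_⟩
  · conv_lhs => rw [block3_eta M, k1, k9, k3, k2, k6]
    rfl
  · simpa using h5

end Block

/-! ### The dressing field -/

section Dressing

variable {m : ℕ} {U : Set (Coord m)} {x : Coord m} {ϖ : Form1 m (Idx m)}

theorem eta_transpose (m : ℕ) : (eta m).transpose = eta m := Matrix.diagonal_transpose _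

theorem etaT_eq_mulVec (r : Fin m → ℝ) : etaT r = Matrix.mulVec (eta m) r := by
  rw [etaT, eta_inv, ← Matrix.mulVec_transpose, eta_transpose]

theorem eta_mulVec_etaT (r : Fin m → ℝ) : Matrix.mulVec (eta m) (etaT r) = r := by
  rw [etaT_eq_mulVec, Matrix.mulVec_mulVec, eta_mul_eta, Matrix.one_mulVec]

theorem etaT_vecMul_eta (r : Fin m → ℝ) : Matrix.vecMul (etaT r) (eta m) = r := by
  rw [← Matrix.mulVec_transpose, eta_transpose, eta_mulVec_etaT]

theorem etaT_add (r s : Fin m → ℝ) : etaT (r + s) = etaT r + etaT s := Matrix.add_vecMul _ _ _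

theorem etaT_smul (c : ℝ) (r : Fin m → ℝ) : etaT (c • r) = c • etaT r := Matrix.smul_vecMul _ _ _

theorem dotProduct_etaT_comm (r s : Fin m → ℝ) : r ⬝ᵥ etaT s = s ⬝ᵥ etaT r := by
  conv_lhs => rw [etaT_eq_mulVec, Matrix.dotProduct_mulVec, ← Matrix.mulVec_transpose,
    eta_transpose, ← etaT_eq_mulVec, dotProduct_comm]

theorem mem_conformalLie_iff_skew (M : Matrix (Idx m) (Idx m) ℝ) :
    M ∈ conformalLie m ↔ M.transpose * sigmaForm m + sigmaForm m * M = 0 := by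
  rw [mem_skewAdjointMatricesSubmodule, ← eq_neg_iff_add_eq_zero, ← Matrix.mul_neg]
  rfl

theorem bot_top_of_mem {M : Matrix (Idx m) (Idx m) ℝ} (hM : M ∈ conformalLie m) :
    M bot top = 0 := by
  obtain ⟨ε, ι, τ, v, -, rfl⟩ := (mem_conformalLie_iff M).1 hM
  rfl

/-- The total dressing field `u₁u₀`. -/
noncomputable def dress (ϖ : Form1 m (Idx m)) (x : Coord m) : Matrix (Idx m) (Idx m) ℝ :=
  u1 ϖ x * u0 ϖ x

theorem qField_vecMul (he : IsUnit (vielbein ϖ x)) :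
    Matrix.vecMul (qField ϖ x) (vielbein ϖ x) = aCoef ϖ x := by
  rw [qField, Matrix.vecMul_vecMul, Matrix.nonsing_inv_mul _ (isUnit_det_of_isUnit he),
    Matrix.vecMul_one]

theorem dress_eq (he : IsUnit (vielbein ϖ x)) :
    dress ϖ x = block3 1 (aCoef ϖ x) (1 / 2 * (qField ϖ x ⬝ᵥ etaT (qField ϖ x)))
      0 (vielbein ϖ x) (etaT (qField ϖ x)) 0 0 1 := by
  rw [dress, u1, u0, block3_mul, qField_vecMul he]
  congr 1 <;> simp

theorem isUnit_dress (he : IsUnit (vielbein ϖ x)) : IsUnit (dress ϖ x) := by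
  rw [dress_eq he]
  exact isUnit_block3 one_ne_zero one_ne_zero he

theorem isUnit_eta (m : ℕ) : IsUnit (eta m) := IsUnit.of_mul_eq_one _ (eta_mul_eta m)

theorem isUnit_metric (he : IsUnit (vielbein ϖ x)) : IsUnit (metric ϖ x) :=
  ((Matrix.isUnit_transpose _).2 he |>.mul (isUnit_eta m)).mul he

theorem metric_transpose (ϖ : Form1 m (Idx m)) (x : Coord m) :
    (metric ϖ x).transpose = metric ϖ x := by
  simp [metric, Matrix.transpose_mul, eta_transpose, Matrix.mul_assoc]

theorem metric_symm (ϖ : Form1 m (Idx m)) (x : Coord m) (i j : Fin m) :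
    metric ϖ x i j = metric ϖ x j i :=
  congrFun (congrFun (metric_transpose ϖ x) j) i

/-- The inversion `u₁` preserves `Σ`, while `u₀` turns `η` into `eᵀηe`. The factor ½ in the corner
of `u₁` makes the last diagonal entry vanish: `-½qqᵗ + qqᵗ - ½qqᵗ = 0`. -/
theorem dress_form (he : IsUnit (vielbein ϖ x)) :
    (dress ϖ x).transpose * sigmaForm m * dress ϖ x = metricForm (metric ϖ x) := by
  have hq := qField_vecMul he
  have h1 : Matrix.vecMul (Matrix.vecMul (etaT (qField ϖ x)) (eta m)) (vielbein ϖ x)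
      = aCoef ϖ x := by rw [etaT_vecMul_eta, hq]
  have h2 : Matrix.mulVec ((vielbein ϖ x).transpose * eta m) (etaT (qField ϖ x))
      = aCoef ϖ x := by
    rw [← Matrix.mulVec_mulVec, eta_mulVec_etaT, Matrix.mulVec_transpose, hq]
  rw [dress_eq he, block3_transpose, sigmaForm, block3_mul, block3_mul, metricForm]
  congr 1
  · simp
  · ext; simp
  · simp
  · ext; simp
  · ext; simp [metric]
  · ext; simp [h2]
  · simp
  · ext; simp [h1]
  · simp [etaT_vecMul_eta]
    ring

theorem contDiffOn_block3 {a b k l : Coord m → ℝ} {r c d s : Coord m → Fin m → ℝ}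
    {M : Coord m → Matrix (Fin m) (Fin m) ℝ}
    (ha : ContDiffOn ℝ ∞ a U) (hr : ∀ i, ContDiffOn ℝ ∞ (fun x => r x i) U)
    (hb : ContDiffOn ℝ ∞ b U) (hc : ∀ i, ContDiffOn ℝ ∞ (fun x => c x i) U)
    (hM : SmoothMat U M) (hd : ∀ i, ContDiffOn ℝ ∞ (fun x => d x i) U)
    (hk : ContDiffOn ℝ ∞ k U) (hs : ∀ i, ContDiffOn ℝ ∞ (fun x => s x i) U)
    (hl : ContDiffOn ℝ ∞ l U) :
    SmoothMat U fun x => block3 (a x) (r x) (b x) (c x) (M x) (d x) (k x) (s x) (l x) := by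
  intro i j
  rcases i with ⟨⟩ | i | ⟨⟩ <;> rcases j with ⟨⟩ | j | ⟨⟩
  exacts [ha, hr j, hb, hc i, hM i j, hd i, hk, hs j, hl]

theorem contDiffOn_vecMul {r : Coord m → Fin m → ℝ} {M : Coord m → Matrix (Fin m) (Fin m) ℝ}
    (hr : ∀ i, ContDiffOn ℝ ∞ (fun x => r x i) U) (hM : SmoothMat U M) (j : Fin m) :
    ContDiffOn ℝ ∞ (fun x => Matrix.vecMul (r x) (M x) j) U := by
  simp only [Matrix.vecMul, dotProduct]
  exact ContDiffOn.sum fun i _ => (hr i).mul (hM i j)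

theorem contDiffOn_dotProduct {r s : Coord m → Fin m → ℝ}
    (hr : ∀ i, ContDiffOn ℝ ∞ (fun x => r x i) U) (hs : ∀ i, ContDiffOn ℝ ∞ (fun x => s x i) U) :
    ContDiffOn ℝ ∞ (fun x => r x ⬝ᵥ s x) U :=
  ContDiffOn.sum fun i _ => (hr i).mul (hs i)

namespace IsCartanConnection

theorem smoothMat (h : IsCartanConnection U ϖ) (μ : Fin m) : SmoothMat U fun x => ϖ x μ :=
  h.smooth μ

theorem smoothMat_vielbein (h : IsCartanConnection U ϖ) : SmoothMat U (vielbein ϖ) :=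
  fun i j => h.smooth j (mid i) top

theorem contDiffOn_qField (h : IsCartanConnection U ϖ) (i : Fin m) :
    ContDiffOn ℝ ∞ (fun x => qField ϖ x i) U :=
  contDiffOn_vecMul (fun μ => h.smooth μ top top) (h.smoothMat_vielbein.inv h.soldering) i

theorem contDiffOn_etaT_qField (h : IsCartanConnection U ϖ) (i : Fin m) :
    ContDiffOn ℝ ∞ (fun x => etaT (qField ϖ x) i) U :=
  contDiffOn_vecMul h.contDiffOn_qField (smoothMat_const _) i

theorem smoothMat_dress (h : IsCartanConnection U ϖ) : SmoothMat U (dress ϖ) :=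
  (contDiffOn_block3 contDiffOn_const h.contDiffOn_qField
    (contDiffOn_const.mul (contDiffOn_dotProduct h.contDiffOn_qField h.contDiffOn_etaT_qField))
    (fun _ => contDiffOn_const) (smoothMat_const _) h.contDiffOn_etaT_qField contDiffOn_const
    (fun _ => contDiffOn_const) contDiffOn_const).mul
  (contDiffOn_block3 contDiffOn_const (fun _ => contDiffOn_const) contDiffOn_const
    (fun _ => contDiffOn_const) h.smoothMat_vielbein (fun _ => contDiffOn_const) contDiffOn_const
    (fun _ => contDiffOn_const) contDiffOn_const)

theorem smoothMat_metric (h : IsCartanConnection U ϖ) : SmoothMat U (metric ϖ) :=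
  (h.smoothMat_vielbein.transpose.mul (smoothMat_const _)).mul h.smoothMat_vielbein

theorem isUnit_dress (h : IsCartanConnection U ϖ) (x : Coord m) (hx : x ∈ U) :
    IsUnit (dress ϖ x) := ConformalCartan.isUnit_dress (h.soldering x hx)

theorem skew (h : IsCartanConnection U ϖ) (x : Coord m) (hx : x ∈ U) (μ : Fin m) :
    (ϖ x μ).transpose * sigmaForm m + sigmaForm m * ϖ x μ = 0 :=
  (mem_conformalLie_iff_skew _).1 (h.mem_lie x hx μ)

/-- The first column of the dressing is a constant basis vector, so `du` does not contribute to it.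
What remains is a triangular system for the first column `(t, c, 0)` of `ϖ₀`: `e c = e_μ` forces `c
= δ_μ`, and then `t + a·δ_μ = a_μ` forces `t = 0`. -/
theorem varpi0_top_col (h : IsCartanConnection U ϖ) (hU : IsOpen U) (hx : x ∈ U) (μ : Fin m) :
    varpi0 ϖ x μ top top = 0 ∧ (fun ρ => varpi0 ϖ x μ (mid ρ) top) = Pi.single μ 1 := by
  have he := h.soldering x hx
  have hu := h.isUnit_dress x hx
  have hmul : dress ϖ x * varpi0 ϖ x μ = ϖ x μ * dress ϖ x + matPd μ (dress ϖ) x :=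
    mul_gauge1 ϖ hu μ
  have hcol : ∀ i, (dress ϖ x * varpi0 ϖ x μ) i top = ϖ x μ i top := by
    intro i
    have h0 : matPd μ (dress ϖ) x i top = 0 := by
      have h1 : pd μ (fun y => dress ϖ y i top) x = pd μ (fun _ => (1 : Matrix (Idx m) (Idx m) ℝ) i top) x := by
        refine pd_congr hU (fun y hy => ?_) hx μ
        rw [dress_eq (h.soldering y hy), block3_one]
        rcases i with ⟨⟩ | i | ⟨⟩ <;> rfl
      rw [pd_const] at h1
      exact h1
    rw [hmul, Matrix.add_apply, h0, add_zero, dress_eq he]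
    simp [Matrix.mul_apply, Fintype.sum_sum_type, block3]
  have h1 := hcol top
  have h2 := fun a => hcol (mid a)
  have h3 := hcol bot
  rw [bot_top_of_mem (h.mem_lie x hx μ)] at h3
  rw [dress_eq he] at h1 h2 h3
  simp only [Matrix.mul_apply, Fintype.sum_sum_type, block3, Finset.univ_unique,
    Matrix.of_apply, Finset.sum_singleton, PUnit.default_eq_unit, one_mul, Pi.zero_apply, zero_mul,
    Finset.sum_const_zero, zero_add] at h1 h2 h3
  simp only [h3, mul_zero, add_zero] at h1 h2
  have hcolv : (fun ρ => varpi0 ϖ x μ (mid ρ) top) = Pi.single μ 1 := by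
    have : Matrix.mulVec (vielbein ϖ x) (fun ρ => varpi0 ϖ x μ (mid ρ) top)
        = Matrix.mulVec (vielbein ϖ x) (Pi.single μ 1) := by
      rw [Matrix.mulVec_single_one]
      exact funext h2
    exact Matrix.mulVec_injective_of_isUnit he this
  refine ⟨?_, hcolv⟩
  have : ∑ ρ, aCoef ϖ x ρ * varpi0 ϖ x μ (mid ρ) top = aCoef ϖ x μ := by
    change aCoef ϖ x ⬝ᵥ (fun ρ => varpi0 ϖ x μ (mid ρ) top) = _
    rw [hcolv, dotProduct_single_one]
  rw [this] at h1
  change _ + aCoef ϖ x μ = aCoef ϖ x μ at h1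
  linarith

/-- Skewness of `ϖ` for `Σ` is carried by `u` to compatibility with `metricForm g`, whose derivative
has only a middle block. The second conjunct is `∇g = 0`. -/
theorem varpi0_shape (h : IsCartanConnection U ϖ) (hU : IsOpen U) (hx : x ∈ U) (μ : Fin m) :
    varpi0 ϖ x μ =
        block3 0 (fun ν => Pten ϖ x μ ν) 0
          (Pi.single μ 1) (Matrix.of fun ρ ν => Gam ϖ x ρ μ ν)
            (fun ρ => ∑ l, (metric ϖ x)⁻¹ ρ l * Pten ϖ x μ l)
          0 (fun ν => metric ϖ x μ ν) 0 ∧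
      (Matrix.of fun ρ ν => Gam ϖ x ρ μ ν).transpose * metric ϖ x
        + metric ϖ x * (Matrix.of fun ρ ν => Gam ϖ x ρ μ ν) = matPd μ (metric ϖ) x := by
  have hsk := gauge1_skew (h.smoothMat_dress.diffMatAt hU hx) (h.isUnit_dress x hx)
    (h.skew x hx μ)
  rw [matPd_congr hU (fun y hy => dress_form (h.soldering y hy)) hx,
    dress_form (h.soldering x hx)] at hsk
  have hd : matPd μ (fun y => metricForm (metric ϖ y)) x
      = block3 0 0 0 0 (matPd μ (metric ϖ) x) 0 0 0 0 := by
    ext i j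
    rcases i with ⟨⟩ | i | ⟨⟩ <;> rcases j with ⟨⟩ | j | ⟨⟩ <;> simp [matPd, metricForm, block3]
  rw [hd] at hsk
  obtain ⟨h1, h2⟩ := skew_metricForm (isUnit_metric (h.soldering x hx)) hsk
  refine ⟨?_, h2⟩
  obtain ⟨h3, h4⟩ := h.varpi0_top_col hU hx μ
  have h5 : (fun ν => ∑ α, varpi0 ϖ x μ (mid α) top * metric ϖ x α ν)
      = fun ν => metric ϖ x μ ν := by
    ext ν
    change (fun ρ => varpi0 ϖ x μ (mid ρ) top) ⬝ᵥ (fun α => metric ϖ x α ν) = _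
    rw [h4, single_one_dotProduct]
  refine Eq.trans h1 ?_
  change block3 (varpi0 ϖ x μ top top) _ 0 (fun ρ => varpi0 ϖ x μ (mid ρ) top) _ _ 0
    (fun ν => ∑ α, varpi0 ϖ x μ (mid α) top * metric ϖ x α ν) (-varpi0 ϖ x μ top top) = _
  rw [h3, h4, h5, neg_zero]
  rfl

/-- The algebraic analogue for the curvature. The second conjunct, antisymmetry of `W` with its
upper index lowered, is what makes its trace vanish in `trace_Wten`. -/
theorem Omega0_shape (h : IsCartanConnection U ϖ) (hU : IsOpen U) (hx : x ∈ U) (μ σ : Fin m) :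
    Omega0 ϖ x μ σ =
        block3 (f0 ϖ x μ σ) (fun ν => Cten ϖ x ν μ σ) 0
          (fun ρ => Tor ϖ x ρ μ σ) (Matrix.of fun ρ ν => Wten ϖ x ρ ν μ σ)
            (fun ρ => ∑ l, (metric ϖ x)⁻¹ ρ l * Cten ϖ x l μ σ)
          0 (fun ν => ∑ α, Tor ϖ x α μ σ * metric ϖ x α ν) (-f0 ϖ x μ σ) ∧
      (Matrix.of fun ρ ν => Wten ϖ x ρ ν μ σ).transpose * metric ϖ x
        + metric ϖ x * (Matrix.of fun ρ ν => Wten ϖ x ρ ν μ σ) = 0 := by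
  have hsk := gauge2_skew (Ω := curvature ϖ) (h.isUnit_dress x hx)
    (curvature_skew hU h.smoothMat h.skew hx μ σ)
  rw [dress_form (h.soldering x hx)] at hsk
  have hd : (0 : Matrix (Idx m) (Idx m) ℝ) = block3 0 0 0 0 0 0 0 0 0 := by
    ext i j
    rcases i with ⟨⟩ | i | ⟨⟩ <;> rcases j with ⟨⟩ | j | ⟨⟩ <;> rfl
  rw [hd] at hsk
  exact skew_metricForm (isUnit_metric (h.soldering x hx)) hsk

theorem curvature_varpi0 (h : IsCartanConnection U ϖ) (hU : IsOpen U) (hx : x ∈ U)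
    (μ σ : Fin m) : Omega0 ϖ x μ σ = curvature (varpi0 ϖ) x μ σ :=
  (curvature_gauge1 hU h.smoothMat h.smoothMat_dress h.isUnit_dress hx μ σ).symm

end IsCartanConnection

end Dressing

/-! ### The Weyl group action -/

section Weyl

variable {m : ℕ} {U : Set (Coord m)} {x : Coord m} {ϖ : Form1 m (Idx m)} {z : Coord m → ℝ}

theorem smoothMat_weylMat (hz : ContDiffOn ℝ ∞ z U) (hpos : ∀ x ∈ U, 0 < z x) :
    SmoothMat U (weylMat z) :=
  contDiffOn_block3 hz (fun _ => contDiffOn_const) contDiffOn_const (fun _ => contDiffOn_const)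
    (smoothMat_const _) (fun _ => contDiffOn_const) contDiffOn_const (fun _ => contDiffOn_const)
    (hz.inv fun x hx => (hpos x hx).ne')

theorem isUnit_weylMat (hz : z x ≠ 0) : IsUnit (weylMat z x) :=
  isUnit_block3 hz (inv_ne_zero hz) isUnit_one

theorem weylMat_form (hz : z x ≠ 0) :
    (weylMat z x).transpose * sigmaForm m * weylMat z x = sigmaForm m := by
  rw [weylMat, block3_transpose, sigmaForm, block3_mul, block3_mul]
  congr 1 <;> simp [hz]

theorem contDiffOn_zeta (hU : IsOpen U) (hz : ContDiffOn ℝ ∞ z U) (hpos : ∀ x ∈ U, 0 < z x)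
    (μ : Fin m) : ContDiffOn ℝ ∞ (fun x => zeta z x μ) U :=
  (hz.inv fun x hx => (hpos x hx).ne').mul (contDiffOn_pd hU hz μ)

/-- The dressing fields and the metric depend on `ϖ` only through `a` and `e`, so this part of the
first column is all of `ϖ^W` that they require. -/
theorem weylAct_top_col (hz : z x ≠ 0) (μ : Fin m) :
    weylAct z ϖ x μ top top = ϖ x μ top top + zeta z x μ ∧
      ∀ a, weylAct z ϖ x μ (mid a) top = z x * ϖ x μ (mid a) top := by
  have hmul : weylMat z x * weylAct z ϖ x μ = ϖ x μ * weylMat z x + matPd μ (weylMat z) x :=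
    mul_gauge1 ϖ (isUnit_weylMat hz) μ
  refine ⟨?_, fun a => ?_⟩
  · have h := congrFun (congrFun hmul top) top
    simp [Matrix.mul_apply, Fintype.sum_sum_type, weylMat, block3, matPd] at h
    rw [zeta]
    field_simp
    linarith
  · have h := congrFun (congrFun hmul (mid a)) top
    simp [Matrix.mul_apply, Fintype.sum_sum_type, weylMat, block3, matPd, Matrix.one_apply] at h
    linarith

theorem aCoef_weylAct (hz : z x ≠ 0) : aCoef (weylAct z ϖ) x = aCoef ϖ x + zeta z x :=
  funext fun μ => (weylAct_top_col hz μ).1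

theorem vielbein_weylAct (hz : z x ≠ 0) : vielbein (weylAct z ϖ) x = z x • vielbein ϖ x :=
  Matrix.ext fun a μ => (weylAct_top_col hz μ).2 a

theorem metric_weylAct (hz : z x ≠ 0) : metric (weylAct z ϖ) x = z x ^ 2 • metric ϖ x := by
  simp [metric, vielbein_weylAct hz, smul_smul, pow_two]

theorem inv_smul_of_isUnit {A : Matrix (Fin m) (Fin m) ℝ} {c : ℝ} (hc : c ≠ 0) (hA : IsUnit A) :
    (c • A)⁻¹ = c⁻¹ • A⁻¹ := by
  refine Matrix.inv_eq_right_inv ?_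
  rw [smul_mul_smul_comm, mul_inv_cancel₀ hc, Matrix.mul_nonsing_inv _ (isUnit_det_of_isUnit hA),
    one_smul]

theorem metric_inv_weylAct (hz : z x ≠ 0) (he : IsUnit (vielbein ϖ x)) :
    (metric (weylAct z ϖ) x)⁻¹ = (z x ^ 2)⁻¹ • (metric ϖ x)⁻¹ := by
  rw [metric_weylAct hz, inv_smul_of_isUnit (pow_ne_zero 2 hz) (isUnit_metric he)]

theorem isUnit_smul {A : Matrix (Fin m) (Fin m) ℝ} {c : ℝ} (hc : c ≠ 0) (hA : IsUnit A) :
    IsUnit (c • A) := by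
  refine IsUnit.of_mul_eq_one (c⁻¹ • A⁻¹) ?_
  rw [smul_mul_smul_comm, mul_inv_cancel₀ hc, Matrix.mul_nonsing_inv _ (isUnit_det_of_isUnit hA),
    one_smul]

/-- The Weyl transform of a conformal Cartan connection is a conformal Cartan connection. -/
theorem IsCartanConnection.weylAct (h : IsCartanConnection U ϖ) (hU : IsOpen U)
    (hz : ContDiffOn ℝ ∞ z U) (hpos : ∀ x ∈ U, 0 < z x) :
    IsCartanConnection U (weylAct z ϖ) where
  smooth := smoothMat_gauge1 hU h.smoothMat (smoothMat_weylMat hz hpos)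
    fun x hx => isUnit_weylMat (hpos x hx).ne'
  mem_lie x hx μ := by
    have hs := gauge1_skew ((smoothMat_weylMat hz hpos).diffMatAt hU hx)
      (isUnit_weylMat (hpos x hx).ne') (h.skew x hx μ)
    rw [matPd_congr (N := fun _ => sigmaForm m) hU
      (fun y hy => weylMat_form (hpos y hy).ne') hx, weylMat_form (hpos x hx).ne',
      matPd_const] at hs
    exact (mem_conformalLie_iff_skew _).2 hs
  soldering x hx := by
    rw [vielbein_weylAct (hpos x hx).ne']
    exact isUnit_smul (hpos x hx).ne' (h.soldering x hx)

theorem curvature_weylAct (h : IsCartanConnection U ϖ) (hU : IsOpen U)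
    (hz : ContDiffOn ℝ ∞ z U) (hpos : ∀ x ∈ U, 0 < z x) (hx : x ∈ U) (μ σ : Fin m) :
    curvature (weylAct z ϖ) x μ σ = gauge2 (curvature ϖ) (weylMat z) x μ σ :=
  curvature_gauge1 hU h.smoothMat (smoothMat_weylMat hz hpos)
    (fun x hx => isUnit_weylMat (hpos x hx).ne') hx μ σ

/-- The Weyl transform of a normal conformal Cartan connection is normal. -/
theorem IsNormal.weylAct (hn : IsNormal U ϖ) (h : IsCartanConnection U ϖ) (hU : IsOpen U)
    (hz : ContDiffOn ℝ ∞ z U) (hpos : ∀ x ∈ U, 0 < z x) : IsNormal U (weylAct z ϖ) := by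
  have key : ∀ x ∈ U, ∀ μ σ a,
      curvature (ConformalCartan.weylAct z ϖ) x μ σ (mid a) top
          = curvature ϖ x μ σ (mid a) top * z x ∧
        ∀ b, curvature (ConformalCartan.weylAct z ϖ) x μ σ (mid a) (mid b)
          = curvature ϖ x μ σ (mid a) (mid b) := by
    intro x hx μ σ a
    have hmul := mul_gauge2 (curvature ϖ) (isUnit_weylMat (hpos x hx).ne') μ σ
    rw [← curvature_weylAct h hU hz hpos hx] at hmul
    refine ⟨?_, fun b => ?_⟩
    · have := congrFun (congrFun hmul (mid a)) top
      simpa [Matrix.mul_apply, Fintype.sum_sum_type, weylMat, block3, Matrix.one_apply] using this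
    · have := congrFun (congrFun hmul (mid a)) (mid b)
      simpa [Matrix.mul_apply, Fintype.sum_sum_type, weylMat, block3, Matrix.one_apply] using this
  refine ⟨fun x hx μ σ a => ?_, fun x hx b c => ?_⟩
  · rw [(key x hx μ σ a).1, hn.torsion x hx, zero_mul]
  · have hi : (vielbein (ConformalCartan.weylAct z ϖ) x)⁻¹ = (z x)⁻¹ • (vielbein ϖ x)⁻¹ := by
      rw [vielbein_weylAct (hpos x hx).ne',
        inv_smul_of_isUnit (hpos x hx).ne' (h.soldering x hx)]
    -- `F` is unchanged, and each of the two inverse vielbeins contributes a factor `z⁻¹`.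
    have h0 := congrArg (fun t => (z x)⁻¹ * (z x)⁻¹ * t) (hn.ricci x hx b c)
    simp only [mul_zero, Finset.mul_sum] at h0
    rw [← h0]
    refine Finset.sum_congr rfl fun a _ => Finset.sum_congr rfl fun μ _ =>
      Finset.sum_congr rfl fun σ _ => ?_
    rw [(key x hx μ σ a).2, hi]
    simp only [Matrix.smul_apply, smul_eq_mul]
    ring

theorem zetaSq_eq : zetaSq z ϖ x = zeta z x ⬝ᵥ zetaUp z ϖ x := by
  simp only [zetaSq, zetaUp, dotProduct, Finset.mul_sum, mul_assoc]

theorem vielbein_mulVec_zetaUp (he : IsUnit (vielbein ϖ x)) :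
    Matrix.mulVec (vielbein ϖ x) (zetaUp z ϖ x)
      = etaT (Matrix.vecMul (zeta z x) (vielbein ϖ x)⁻¹) := by
  have h : zetaUp z ϖ x = Matrix.mulVec (metric ϖ x)⁻¹ (zeta z x) := rfl
  rw [h, metric, Matrix.mul_inv_rev, Matrix.mul_inv_rev, eta_inv, Matrix.mulVec_mulVec,
    Matrix.mul_nonsing_inv_cancel_left _ _ (isUnit_det_of_isUnit he), ← Matrix.mulVec_mulVec,
    ← Matrix.transpose_nonsing_inv, Matrix.mulVec_transpose, etaT_eq_mulVec]

/-- With `p = ζ e⁻¹`, the rules `a ↦ a + ζ` and `e ↦ z e` give `q ↦ z⁻¹(q + p)`. Since `e ζ^♯ = pᵗ`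
and `|ζ|² = p pᵗ`, the entries of `W̄` are precisely those that balance the product. -/
theorem weylMat_mul_dress (hz : z x ≠ 0) (he : IsUnit (vielbein ϖ x)) :
    weylMat z x * dress (weylAct z ϖ) x = dress ϖ x * Wbar z ϖ x := by
  have heW : IsUnit (vielbein (weylAct z ϖ) x) := by
    rw [vielbein_weylAct hz]; exact isUnit_smul hz he
  set p := Matrix.vecMul (zeta z x) (vielbein ϖ x)⁻¹ with hp
  have hup : Matrix.mulVec (vielbein ϖ x) (zetaUp z ϖ x) = etaT p := vielbein_mulVec_zetaUp he
  have hpe : Matrix.vecMul p (vielbein ϖ x) = zeta z x := by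
    rw [hp, Matrix.vecMul_vecMul, Matrix.nonsing_inv_mul _ (isUnit_det_of_isUnit he),
      Matrix.vecMul_one]
  have hq : qField (weylAct z ϖ) x = (z x)⁻¹ • (qField ϖ x + p) := by
    have hi : (vielbein (ConformalCartan.weylAct z ϖ) x)⁻¹ = (z x)⁻¹ • (vielbein ϖ x)⁻¹ := by
      rw [vielbein_weylAct hz, inv_smul_of_isUnit hz he]
    rw [qField, hi, aCoef_weylAct hz, Matrix.vecMul_smul, Matrix.add_vecMul]
    rfl
  have hsq : zetaSq z ϖ x = p ⬝ᵥ etaT p := by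
    rw [zetaSq_eq, ← hpe, ← Matrix.dotProduct_mulVec, hup]
  have haz : aCoef ϖ x ⬝ᵥ zetaUp z ϖ x = qField ϖ x ⬝ᵥ etaT p := by
    rw [← qField_vecMul he, ← Matrix.dotProduct_mulVec, hup]
  have hd : (fun ρ => (z x)⁻¹ * zetaUp z ϖ x ρ) = (z x)⁻¹ • zetaUp z ϖ x := rfl
  have hr : (fun ν => z x * zeta z x ν) = z x • zeta z x := rfl
  rw [dress_eq he, dress_eq heW, weylMat, Wbar, block3_mul, block3_mul, aCoef_weylAct hz,
    vielbein_weylAct hz, hq, hsq, hd, hr]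
  congr 1
  · simp
  · ext; simp [Matrix.vecMul_smul]; ring
  -- The corner is the expansion of `½ z⁻¹ (q + p)(q + p)ᵗ`; symmetry of `η` merges the two cross
  -- terms into the `a·ζ^♯` on the other side.
  · simp [etaT_add, etaT_smul, haz, dotProduct_etaT_comm p (qField ϖ x)]
    field_simp
    ring
  · ext; simp
  · ext; simp
  · ext; simp [Matrix.mulVec_smul, hup, etaT_add, etaT_smul]; ring
  · simp
  · ext; simp
  · simp

theorem smoothMat_Wbar (h : IsCartanConnection U ϖ) (hU : IsOpen U)
    (hz : ContDiffOn ℝ ∞ z U) (hpos : ∀ x ∈ U, 0 < z x) : SmoothMat U (Wbar z ϖ) := by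
  have hzi : ContDiffOn ℝ ∞ (fun x => (z x)⁻¹) U := hz.inv fun x hx => (hpos x hx).ne'
  have hζ := contDiffOn_zeta hU hz hpos
  have hg := h.smoothMat_metric.inv fun x hx => isUnit_metric (h.soldering x hx)
  refine contDiffOn_block3 hz (fun i => hz.mul (hζ i)) ((contDiffOn_const.mul hzi).mul ?_)
    (fun _ => contDiffOn_const) (fun i j => hz.mul contDiffOn_const) (fun i => hzi.mul ?_)
    contDiffOn_const (fun _ => contDiffOn_const) hzi
  · exact ContDiffOn.sum fun i _ => ContDiffOn.sum fun j _ => ((hζ i).mul (hg i j)).mul (hζ j)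
  · exact ContDiffOn.sum fun j _ => (hg i j).mul (hζ j)

theorem isUnit_Wbar (hz : z x ≠ 0) : IsUnit (Wbar z ϖ x) :=
  isUnit_block3 hz (inv_ne_zero hz) (isUnit_smul hz isUnit_one)

/-- Both sides equal `ϖ` transformed by the same product, by `weylMat_mul_dress`. That identity is
needed on all of `U`, because the gauge law differentiates the product. -/
theorem varpi0_weylAct (h : IsCartanConnection U ϖ) (hU : IsOpen U)
    (hz : ContDiffOn ℝ ∞ z U) (hpos : ∀ x ∈ U, 0 < z x) (hx : x ∈ U) (μ : Fin m) :
    varpi0 (weylAct z ϖ) x μ = gauge1 (varpi0 ϖ) (Wbar z ϖ) x μ := by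
  have hW := h.weylAct hU hz hpos
  have e1 := gauge1_gauge1 ϖ (isUnit_weylMat (hpos x hx).ne')
    ((smoothMat_weylMat hz hpos).diffMatAt hU hx) (hW.smoothMat_dress.diffMatAt hU hx) μ
  have e2 := gauge1_gauge1 ϖ (h.isUnit_dress x hx) (h.smoothMat_dress.diffMatAt hU hx)
    ((smoothMat_Wbar h hU hz hpos).diffMatAt hU hx) μ
  exact e1.trans ((gauge1_congr ϖ hU
    (fun y hy => weylMat_mul_dress (hpos y hy).ne' (h.soldering y hy)) hx μ).trans e2.symm)

theorem Omega0_weylAct (h : IsCartanConnection U ϖ) (hU : IsOpen U)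
    (hz : ContDiffOn ℝ ∞ z U) (hpos : ∀ x ∈ U, 0 < z x) (hx : x ∈ U) (μ σ : Fin m) :
    Omega0 (weylAct z ϖ) x μ σ = gauge2 (Omega0 ϖ) (Wbar z ϖ) x μ σ := by
  have e0 : Omega0 (weylAct z ϖ) x μ σ
      = gauge2 (gauge2 (curvature ϖ) (weylMat z)) (dress (weylAct z ϖ)) x μ σ := by
    change gauge2 (curvature (weylAct z ϖ)) (dress (weylAct z ϖ)) x μ σ = _
    simp only [gauge2]
    rw [curvature_weylAct h hU hz hpos hx]
    rfl
  have e1 : Omega0 ϖ = gauge2 (curvature ϖ) (dress ϖ) := rfl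
  rw [e0, e1, gauge2_gauge2, gauge2_gauge2]
  simp only [gauge2]
  rw [weylMat_mul_dress (hpos x hx).ne' (h.soldering x hx)]

/-- These are the (2,2) and (1,2) blocks of `W̄ ϖ₀^W = ϖ₀ W̄ + dW̄`. The (1,2) block contains `ζ_ρ
(Γ^ρ_{μν})^W`, so the law for `Γ` comes first. -/
theorem Gam_Pten_weylAct (h : IsCartanConnection U ϖ) (hU : IsOpen U)
    (hz : ContDiffOn ℝ ∞ z U) (hpos : ∀ x ∈ U, 0 < z x) (hx : x ∈ U) (μ ν : Fin m) :
    (∀ ρ, Gam (weylAct z ϖ) x ρ μ ν = Gam ϖ x ρ μ ν + (if ρ = ν then zeta z x μ else 0)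
      + (if ρ = μ then zeta z x ν else 0) - zetaUp z ϖ x ρ * metric ϖ x μ ν) ∧
    Pten (weylAct z ϖ) x μ ν =
      Pten ϖ x μ ν + nablaZeta z ϖ x μ ν - zeta z x μ * zeta z x ν
        + 1 / 2 * zetaSq z ϖ x * metric ϖ x μ ν := by
  have hz0 := (hpos x hx).ne'
  have hmul := mul_gauge1 (varpi0 ϖ) (isUnit_Wbar (ϖ := ϖ) hz0) μ
  have hdz : pd μ z x = z x * zeta z x μ := by rw [zeta, mul_inv_cancel_left₀ hz0]
  rw [← varpi0_weylAct h hU hz hpos hx, ((h.weylAct hU hz hpos).varpi0_shape hU hx μ).1,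
    (h.varpi0_shape hU hx μ).1, metric_weylAct hz0, block3_eta (matPd μ _ _), Wbar, block3_mul,
    block3_mul, block3_add] at hmul
  obtain ⟨⟨-, h2, -⟩, ⟨-, h5, -⟩, -⟩ := block3_inj hmul
  have hG : ∀ ρ, Gam (weylAct z ϖ) x ρ μ ν = Gam ϖ x ρ μ ν + (if ρ = ν then zeta z x μ else 0)
      + (if ρ = μ then zeta z x ν else 0) - zetaUp z ϖ x ρ * metric ϖ x μ ν := by
    intro ρ
    have e := congrFun (congrFun h5 ρ) ν
    have hd : matPd μ (Wbar z ϖ) x (mid ρ) (mid ν) = if ρ = ν then z x * zeta z x μ else 0 := by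
      change pd μ (fun y => z y * (1 : Matrix (Fin m) (Fin m) ℝ) ρ ν) x = _
      split_ifs with hρ
      · subst hρ
        simpa using hdz
      · simp [Matrix.one_apply_ne hρ]
    simp only [Matrix.add_apply, Matrix.of_apply, hd] at e
    simp [Matrix.vecMulVec_apply, Pi.single_apply] at e
    refine mul_left_cancel₀ hz0 ?_
    field_simp at e
    split_ifs at e ⊢ <;> linarith
  refine ⟨hG, ?_⟩
  have e := congrFun h2 ν
  have hd : matPd μ (Wbar z ϖ) x top (mid ν)
      = z x * zeta z x μ * zeta z x ν + z x * pd μ (fun y => zeta z y ν) x := by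
    change pd μ (fun y => z y * zeta z y ν) x = _
    rw [pd_mul (ContDiffOn.diffAt hU hz hx) (ContDiffOn.diffAt hU (contDiffOn_zeta hU hz hpos ν) hx),
      hdz]
  -- The two deltas give `2 ζ_μ ζ_ν`. One copy is cancelled by `dz` in `d(zζ)`, leaving `-ζ_μ ζ_ν`
  -- in `P^W`; likewise the full `|ζ|² g` here, less the half from the corner of `W̄`, leaves
  -- `+½|ζ|² g`.
  have hs : ∑ ρ, zeta z x ρ * Gam (weylAct z ϖ) x ρ μ ν
      = ∑ ρ, zeta z x ρ * Gam ϖ x ρ μ ν + 2 * zeta z x μ * zeta z x ν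
        - zetaSq z ϖ x * metric ϖ x μ ν := by
    simp only [hG, zetaSq_eq, dotProduct, mul_add, mul_sub, Finset.sum_add_distrib,
      Finset.sum_sub_distrib, mul_ite, mul_zero, Finset.sum_ite_eq', Finset.mem_univ, if_true,
      Finset.sum_mul, mul_assoc]
    ring
  have hv : Matrix.vecMul (fun ν => z x * zeta z x ν)
      (Matrix.of fun ρ ν => Gam (weylAct z ϖ) x ρ μ ν) ν
      = z x * ∑ ρ, zeta z x ρ * Gam (weylAct z ϖ) x ρ μ ν := by
    simp only [Matrix.vecMul, dotProduct, Matrix.of_apply, Finset.mul_sum, mul_assoc]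
  simp only [Pi.add_apply, hv, hs, hd] at e
  simp [Matrix.vecMul_smul] at e
  rw [nablaZeta]
  refine mul_left_cancel₀ hz0 ?_
  field_simp at e ⊢
  linarith

/-- The blocks of `W̄ Ω₀^W = Ω₀ W̄`. As `W̄` is upper triangular they can be solved successively:
`T` alone, then `f₀` and `W` from `T`, and finally `C` from `T` and `W`. -/
theorem Omega0_entries_weylAct (h : IsCartanConnection U ϖ) (hU : IsOpen U)
    (hz : ContDiffOn ℝ ∞ z U) (hpos : ∀ x ∈ U, 0 < z x) (hx : x ∈ U) (μ σ : Fin m) :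
    (∀ ρ, Tor (weylAct z ϖ) x ρ μ σ = Tor ϖ x ρ μ σ) ∧
    f0 (weylAct z ϖ) x μ σ = f0 ϖ x μ σ - ∑ l, zeta z x l * Tor ϖ x l μ σ ∧
    (∀ ρ ν, Wten (weylAct z ϖ) x ρ ν μ σ = Wten ϖ x ρ ν μ σ + Tor ϖ x ρ μ σ * zeta z x ν
      - zetaUp z ϖ x ρ * ∑ α, Tor ϖ x α μ σ * metric ϖ x α ν) ∧
    ∀ ν, Cten (weylAct z ϖ) x ν μ σ =
      Cten ϖ x ν μ σ - ∑ l, zeta z x l * Wten ϖ x l ν μ σ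
        + (f0 ϖ x μ σ - ∑ l, zeta z x l * Tor ϖ x l μ σ) * zeta z x ν
        + 1 / 2 * zetaSq z ϖ x * ∑ α, Tor ϖ x α μ σ * metric ϖ x α ν := by
  have hz0 := (hpos x hx).ne'
  have hmul := mul_gauge2 (Omega0 ϖ) (isUnit_Wbar (ϖ := ϖ) hz0) μ σ
  rw [← Omega0_weylAct h hU hz hpos hx, ((h.weylAct hU hz hpos).Omega0_shape hU hx μ σ).1,
    (h.Omega0_shape hU hx μ σ).1, metric_weylAct hz0, Wbar, block3_mul, block3_mul] at hmul
  obtain ⟨⟨h1, h2, -⟩, ⟨h4, h5, -⟩, -⟩ := block3_inj hmul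
  have hT : ∀ ρ, Tor (weylAct z ϖ) x ρ μ σ = Tor ϖ x ρ μ σ := by
    intro ρ
    have e := congrFun h4 ρ
    simpa [Matrix.smul_mulVec, hz0] using e
  have hTg : ∀ ν, ∑ α, Tor (weylAct z ϖ) x α μ σ * (z x ^ 2 • metric ϖ x) α ν
      = z x ^ 2 * ∑ α, Tor ϖ x α μ σ * metric ϖ x α ν := by
    intro ν
    rw [Finset.mul_sum]
    refine Finset.sum_congr rfl fun α _ => ?_
    rw [hT, Matrix.smul_apply, smul_eq_mul]
    ring
  have hf : f0 (weylAct z ϖ) x μ σ = f0 ϖ x μ σ - ∑ l, zeta z x l * Tor ϖ x l μ σ := by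
    have hv : (fun ν => z x * zeta z x ν) ⬝ᵥ (fun ρ => Tor (weylAct z ϖ) x ρ μ σ)
        = z x * ∑ l, zeta z x l * Tor ϖ x l μ σ := by
      simp only [dotProduct, Finset.mul_sum, mul_assoc, hT]
    simp only [hv] at h1
    simp at h1
    exact mul_left_cancel₀ hz0 (by linarith)
  have hW : ∀ ρ ν, Wten (weylAct z ϖ) x ρ ν μ σ = Wten ϖ x ρ ν μ σ + Tor ϖ x ρ μ σ * zeta z x ν
      - zetaUp z ϖ x ρ * ∑ α, Tor ϖ x α μ σ * metric ϖ x α ν := by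
    intro ρ ν
    have e := congrFun (congrFun h5 ρ) ν
    simp only [Matrix.add_apply, Matrix.vecMulVec_apply, hTg] at e
    simp at e
    field_simp at e
    linear_combination e
  refine ⟨hT, hf, hW, fun ν => ?_⟩
  have e := congrFun h2 ν
  have hs : ∑ ρ, zeta z x ρ * Wten (weylAct z ϖ) x ρ ν μ σ
      = ∑ l, zeta z x l * Wten ϖ x l ν μ σ + (∑ l, zeta z x l * Tor ϖ x l μ σ) * zeta z x ν
        - zetaSq z ϖ x * ∑ α, Tor ϖ x α μ σ * metric ϖ x α ν := by
    simp only [hW, zetaSq_eq, dotProduct, mul_add, mul_sub, Finset.sum_add_distrib,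
      Finset.sum_sub_distrib, ← mul_assoc, ← Finset.sum_mul]
  have hv : Matrix.vecMul (fun ν => z x * zeta z x ν)
      (Matrix.of fun ρ ν => Wten (weylAct z ϖ) x ρ ν μ σ) ν
      = z x * ∑ ρ, zeta z x ρ * Wten (weylAct z ϖ) x ρ ν μ σ := by
    simp only [Matrix.vecMul, dotProduct, Matrix.of_apply, Finset.mul_sum, mul_assoc]
  simp only [Pi.add_apply, Pi.smul_apply, smul_eq_mul, hv, hs, hTg] at e
  simp [Matrix.vecMul_smul] at e
  refine mul_left_cancel₀ hz0 ?_
  field_simp at e ⊢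
  linarith

end Weyl

/-! ### The structure equations and the normal case -/

section Normal

variable {m : ℕ} {U : Set (Coord m)} {x : Coord m} {ϖ : Form1 m (Idx m)}

/-- The linear connection `Γ` as a matrix-valued 1-form. -/
noncomputable def gamForm (ϖ : Form1 m (Idx m)) : Form1 m (Fin m) :=
  fun x μ => Matrix.of fun ρ ν => Gam ϖ x ρ μ ν

theorem curvature_congr {I : Type*} [Fintype I] (hU : IsOpen U) {A B : Form1 m I}
    (h : ∀ y ∈ U, ∀ μ, A y μ = B y μ) (hx : x ∈ U) (μ σ : Fin m) :
    curvature A x μ σ = curvature B x μ σ := by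
  simp only [curvature]
  rw [matPd_congr hU (fun y hy => h y hy σ) hx, matPd_congr hU (fun y hy => h y hy μ) hx,
    h x hx, h x hx]

namespace IsCartanConnection

/-- Blocks of `Ω₀ = dϖ₀ + ϖ₀²`. The first column of `ϖ₀` is constant, so in `f₀` and `T` only the
quadratic terms survive. -/
theorem Omega0_structure (h : IsCartanConnection U ϖ) (hU : IsOpen U) (hx : x ∈ U)
    (μ σ : Fin m) :
    f0 ϖ x μ σ = Pten ϖ x μ σ - Pten ϖ x σ μ ∧
    (∀ ρ, Tor ϖ x ρ μ σ = Gam ϖ x ρ μ σ - Gam ϖ x ρ σ μ) ∧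
    ∀ ρ ν, Wten ϖ x ρ ν μ σ = curvature (gamForm ϖ) x μ σ ρ ν
      + ((if ρ = μ then Pten ϖ x σ ν else 0)
        + (∑ l, (metric ϖ x)⁻¹ ρ l * Pten ϖ x μ l) * metric ϖ x σ ν)
      - ((if ρ = σ then Pten ϖ x μ ν else 0)
        + (∑ l, (metric ϖ x)⁻¹ ρ l * Pten ϖ x σ l) * metric ϖ x μ ν) := by
  have hO := h.curvature_varpi0 hU hx μ σ
  have hc : curvature (varpi0 ϖ) x μ σ = (matPd μ (fun y => varpi0 ϖ y σ) x
      - matPd σ (fun y => varpi0 ϖ y μ) x) + (varpi0 ϖ x μ * varpi0 ϖ x σ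
      - varpi0 ϖ x σ * varpi0 ϖ x μ) := by
    simp only [curvature]
    abel
  have hd : ∀ (α β : Fin m), matPd α (fun y => varpi0 ϖ y β) x top top = 0 ∧
      ∀ ρ, matPd α (fun y => varpi0 ϖ y β) x (mid ρ) top = 0 := by
    intro α β
    refine ⟨?_, fun ρ => ?_⟩
    · have := pd_congr (g := fun _ => 0) hU (fun y hy => (h.varpi0_top_col hU hy β).1) hx α
      rwa [pd_const] at this
    · have := pd_congr (g := fun _ => (Pi.single β 1 : Fin m → ℝ) ρ) hU
        (fun y hy => congrFun (h.varpi0_top_col hU hy β).2 ρ) hx α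
      rwa [pd_const] at this
  have hq : ∀ α β : Fin m, _ := fun α β =>
    congrArg₂ (· * ·) (h.varpi0_shape hU hx α).1 (h.varpi0_shape hU hx β).1
  simp only [block3_mul] at hq
  rw [hc, hq, hq] at hO
  refine ⟨?_, fun ρ => ?_, fun ρ ν => ?_⟩
  · have e := congrFun (congrFun hO top) top
    simp only [Matrix.add_apply, Matrix.sub_apply, (hd _ _).1] at e
    exact e.trans (by simp [block3])
  · have e := congrFun (congrFun hO (mid ρ)) top
    simp only [Matrix.add_apply, Matrix.sub_apply, (hd _ _).2] at e
    exact e.trans (by simp [block3])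
  · have e := congrFun (congrFun hO (mid ρ)) (mid ν)
    have hg : curvature (gamForm ϖ) x μ σ ρ ν
        = matPd μ (fun y => varpi0 ϖ y σ) x (mid ρ) (mid ν)
          - matPd σ (fun y => varpi0 ϖ y μ) x (mid ρ) (mid ν)
          + (gamForm ϖ x μ * gamForm ϖ x σ) ρ ν - (gamForm ϖ x σ * gamForm ϖ x μ) ρ ν := rfl
    rw [hg]
    simp only [Matrix.add_apply, Matrix.sub_apply] at e
    refine Eq.trans e ?_
    simp only [block3, Matrix.of_apply, Matrix.add_apply, Matrix.vecMulVec_apply, Pi.single_apply,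
      ite_mul, one_mul, zero_mul, gamForm]
    ring

/-- A torsion-free metric connection is the Levi-Civita connection. -/
theorem Gam_eq_christoffel (h : IsCartanConnection U ϖ) (hU : IsOpen U) (hx : x ∈ U)
    (hT : ∀ ρ μ σ, Tor ϖ x ρ μ σ = 0) (ρ μ ν : Fin m) :
    Gam ϖ x ρ μ ν = christoffel (metric ϖ) x ρ μ ν := by
  have hsym : ∀ ρ μ σ, Gam ϖ x ρ μ σ = Gam ϖ x ρ σ μ := fun ρ μ σ => by
    have := (h.Omega0_structure hU hx μ σ).2.1 ρ
    rw [hT] at this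
    linarith
  -- Koszul's argument: `L` is `Γ` with its upper index lowered, symmetric in the last two slots,
  -- and metricity reads `∂_μ g_{νl} = L_{lμν} + L_{νμl}`. The alternating sum of three such
  -- equations isolates `2L`.
  set L : Fin m → Fin m → Fin m → ℝ := fun l μ ν => ∑ ρ, metric ϖ x l ρ * Gam ϖ x ρ μ ν with hL
  have hLsym : ∀ l μ ν, L l μ ν = L l ν μ := fun l μ ν => by
    simp only [hL]
    exact Finset.sum_congr rfl fun ρ _ => by rw [hsym]
  have hcompat : ∀ μ ν l, pd μ (fun y => metric ϖ y ν l) x = L l μ ν + L ν μ l := by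
    intro μ ν l
    have := congrFun (congrFun (h.varpi0_shape hU hx μ).2 ν) l
    rw [show pd μ (fun y => metric ϖ y ν l) x = matPd μ (metric ϖ) x ν l from rfl, ← this]
    simp only [Matrix.add_apply, Matrix.mul_apply, Matrix.transpose_apply, Matrix.of_apply, hL]
    congr 1
    exact Finset.sum_congr rfl fun ρ _ => by rw [metric_symm ϖ x ρ l, mul_comm]
  have hG : Matrix.mulVec (metric ϖ x)⁻¹ (fun l => L l μ ν) = fun ρ => Gam ϖ x ρ μ ν := by
    have : (fun l => L l μ ν) = Matrix.mulVec (metric ϖ x) (fun ρ => Gam ϖ x ρ μ ν) := rfl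
    rw [this, Matrix.mulVec_mulVec, Matrix.nonsing_inv_mul _
      (isUnit_det_of_isUnit (isUnit_metric (h.soldering x hx))), Matrix.one_mulVec]
  rw [← congrFun hG ρ, christoffel, Matrix.mulVec, dotProduct, Finset.mul_sum]
  refine Finset.sum_congr rfl fun l _ => ?_
  simp only [hcompat]
  rw [hLsym ν μ l, hLsym μ ν l, hLsym l ν μ]
  ring

/-- A matrix that is skew-adjoint for an invertible form is traceless. This is later used for the
symmetry of the Ricci tensor. -/
theorem trace_Wten (h : IsCartanConnection U ϖ) (hU : IsOpen U) (hx : x ∈ U) (μ σ : Fin m) :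
    ∑ ρ, Wten ϖ x ρ ρ μ σ = 0 := by
  have hdet := isUnit_det_of_isUnit (isUnit_metric (h.soldering x hx))
  set W : Matrix (Fin m) (Fin m) ℝ := Matrix.of fun ρ ν => Wten ϖ x ρ ν μ σ with hW
  have e : W.transpose * metric ϖ x + metric ϖ x * W = 0 := (h.Omega0_shape hU hx μ σ).2
  have e2 := congrArg (fun M => ((metric ϖ x)⁻¹ * M).trace) e
  simp only [mul_add, Matrix.trace_add, Matrix.nonsing_inv_mul_cancel_left _ _ hdet,
    Matrix.mul_zero, Matrix.trace_zero] at e2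
  rw [Matrix.trace_mul_comm, Matrix.mul_nonsing_inv_cancel_right _ _ hdet,
    Matrix.trace_transpose] at e2
  have : W.trace = 0 := by linarith
  exact this

/-- In `u Ω₀ = Ω u` the (2,1) block is `e T = Θ = 0`; the terms coupling the (2,2) block to `T` and
`Θ` then drop out and leave `e W = F e`. Thus `W` is `F` in coordinate indices, and the Ricci
condition on `F` can be moved to `W`. -/
theorem Tor_Wten_frame (h : IsCartanConnection U ϖ) (hU : IsOpen U) (hx : x ∈ U)
    (hΘ : ∀ μ σ a, curvature ϖ x μ σ (mid a) top = 0) (μ σ : Fin m) :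
    (∀ ρ, Tor ϖ x ρ μ σ = 0) ∧
    vielbein ϖ x * (Matrix.of fun ρ ν => Wten ϖ x ρ ν μ σ)
      = (Matrix.of fun a b => curvature ϖ x μ σ (mid a) (mid b)) * vielbein ϖ x := by
  have he := h.soldering x hx
  have hmul : dress ϖ x * Omega0 ϖ x μ σ = curvature ϖ x μ σ * dress ϖ x :=
    mul_gauge2 (curvature ϖ) (h.isUnit_dress x hx) μ σ
  rw [(h.Omega0_shape hU hx μ σ).1, dress_eq he, block3_eta (curvature ϖ x μ σ), block3_mul,
    block3_mul] at hmul
  obtain ⟨-, ⟨h4, h5, -⟩, -⟩ := block3_inj hmul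
  have hT : (fun ρ => Tor ϖ x ρ μ σ) = 0 := by
    refine Matrix.mulVec_injective_of_isUnit he ?_
    ext a
    simpa [hΘ] using congrFun h4 a
  have hT' : ∀ ρ, Tor ϖ x ρ μ σ = 0 := congrFun hT
  refine ⟨hT', ?_⟩
  ext a b
  have e := congrFun (congrFun h5 a) b
  simpa [Matrix.vecMulVec_apply, hT', hΘ] using e

/-- The consequences of normality for the tensors built from a conformal Cartan connection. -/
theorem normal (h : IsCartanConnection U ϖ) (hU : IsOpen U) (hn : IsNormal U ϖ) (hm : 3 ≤ m)
    (hx : x ∈ U) :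
    (∀ ρ μ ν, Gam ϖ x ρ μ ν = christoffel (metric ϖ) x ρ μ ν) ∧
    (∀ μ ν, Pten ϖ x μ ν = schouten (metric ϖ) x μ ν) ∧
    (∀ ρ μ σ, Tor ϖ x ρ μ σ = 0) ∧
    (∀ ν σ, ∑ ρ, Wten ϖ x ρ ν ρ σ = 0) ∧
    (∀ μ σ, f0 ϖ x μ σ = 0) := by
  -- Stated on all of `U`, not only at `x`, because the curvature of `Γ` differentiates it.
  have hTU : ∀ y ∈ U, ∀ ρ μ σ, Tor ϖ y ρ μ σ = 0 := fun y hy ρ μ σ =>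
    (h.Tor_Wten_frame hU hy (hn.torsion y hy) μ σ).1 ρ
  have hΓU : ∀ y ∈ U, ∀ ρ μ ν, Gam ϖ y ρ μ ν = christoffel (metric ϖ) y ρ μ ν :=
    fun y hy => h.Gam_eq_christoffel hU hy (hTU y hy)
  have hsym : ∀ y ∈ U, ∀ ρ μ σ, Gam ϖ y ρ μ σ = Gam ϖ y ρ σ μ := fun y hy ρ μ σ => by
    have := (h.Omega0_structure hU hy μ σ).2.1 ρ
    rw [hTU y hy] at this
    linarith
  have he := h.soldering x hx
  have hdet := isUnit_det_of_isUnit he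
  have hgdet := isUnit_det_of_isUnit (isUnit_metric he)
  set g := metric ϖ x with hg
  have hWric : ∀ ν σ, ∑ ρ, Wten ϖ x ρ ν ρ σ = 0 := by
    -- The Ricci contraction of `F` with its last form index kept in coordinates. Normality says `H
    -- e⁻¹ = 0`, hence `H = 0`, and the contraction of `W` is `H` with `b` converted by `e`.
    set H : Matrix (Fin m) (Fin m) ℝ := Matrix.of fun b σ =>
      ∑ a, ∑ μ, curvature ϖ x μ σ (mid a) (mid b) * (vielbein ϖ x)⁻¹ μ a with hH
    have hH0 : H = 0 := by
      have e : H * (vielbein ϖ x)⁻¹ = 0 := by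
        ext b c
        rw [Matrix.zero_apply, ← hn.ricci x hx b c]
        simp only [Matrix.mul_apply, hH, Matrix.of_apply, Finset.sum_mul]
        rw [Finset.sum_comm]
        refine Finset.sum_congr rfl fun a _ => ?_
        rw [Finset.sum_comm]
      have := congrArg (· * vielbein ϖ x) e
      simpa [Matrix.nonsing_inv_mul_cancel_right _ _ hdet] using this
    intro ν σ
    have hW : ∀ ρ, Wten ϖ x ρ ν ρ σ = ∑ b, ∑ a, (vielbein ϖ x)⁻¹ ρ a *
        curvature ϖ x ρ σ (mid a) (mid b) * vielbein ϖ x b ν := by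
      intro ρ
      have e := congrArg ((vielbein ϖ x)⁻¹ * ·) (h.Tor_Wten_frame hU hx (hn.torsion x hx) ρ σ).2
      simp only [Matrix.nonsing_inv_mul_cancel_left _ _ hdet] at e
      have e' := congrFun (congrFun e ρ) ν
      rw [← Matrix.mul_assoc] at e'
      refine Eq.trans e' ?_
      simp only [Matrix.mul_apply, Finset.sum_mul, Matrix.of_apply]
    have hz : ∀ b, H b σ * vielbein ϖ x b ν = 0 := fun b => by rw [hH0]; simp
    simp only [hW]
    rw [Finset.sum_comm]
    refine Finset.sum_eq_zero fun b _ => ?_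
    rw [← hz b, hH, Matrix.of_apply, Finset.sum_comm, Finset.sum_mul]
    refine Finset.sum_congr rfl fun a _ => ?_
    rw [Finset.sum_mul]
    exact Finset.sum_congr rfl fun μ _ => by ring
  set R := curvature (gamForm ϖ) x with hR
  have hW : ∀ ρ ν μ σ, Wten ϖ x ρ ν μ σ = R μ σ ρ ν
      + ((if ρ = μ then Pten ϖ x σ ν else 0) + (∑ l, g⁻¹ ρ l * Pten ϖ x μ l) * g σ ν)
      - ((if ρ = σ then Pten ϖ x μ ν else 0) + (∑ l, g⁻¹ ρ l * Pten ϖ x σ l) * g μ ν) :=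
    fun ρ ν μ σ => (h.Omega0_structure hU hx μ σ).2.2 ρ ν
  have hlow : ∀ α β, ∑ ρ, (∑ l, g⁻¹ ρ l * Pten ϖ x α l) * g β ρ = Pten ϖ x α β := by
    intro α β
    have e : Matrix.mulVec g (Matrix.mulVec g⁻¹ (Pten ϖ x α)) = Pten ϖ x α := by
      rw [Matrix.mulVec_mulVec, Matrix.mul_nonsing_inv _ hgdet, Matrix.one_mulVec]
    rw [← congrFun e β]
    exact Finset.sum_congr rfl fun ρ _ => mul_comm _ _
  -- First Bianchi identity: symmetry of `Γ` makes the derivative and the quadratic terms cancel in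
  -- pairs in the cyclic sum.
  have hbianchi : ∀ ρ ν μ σ, R μ σ ρ ν + R σ ν ρ μ + R ν μ ρ σ = 0 := by
    intro ρ ν μ σ
    have hpd : ∀ α β γ : Fin m, matPd α (fun y => gamForm ϖ y β) x ρ γ
        = matPd α (fun y => gamForm ϖ y γ) x ρ β := fun α β γ =>
      pd_congr hU (fun y hy => hsym y hy ρ β γ) hx α
    have hq : ∀ α β γ : Fin m, (gamForm ϖ x α * gamForm ϖ x β) ρ γ
        = (gamForm ϖ x α * gamForm ϖ x γ) ρ β := fun α β γ => by
      simp only [Matrix.mul_apply, gamForm, Matrix.of_apply]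
      exact Finset.sum_congr rfl fun l _ => by rw [hsym x hx l β γ]
    simp only [hR, curvature, Matrix.add_apply, Matrix.sub_apply]
    rw [hpd μ σ ν, hpd σ μ ν, hpd ν μ σ, hq μ σ ν, hq σ μ ν, hq ν μ σ]
    ring
  have hanti : ∀ ρ ν μ σ, R μ σ ρ ν = -R σ μ ρ ν := by
    intro ρ ν μ σ
    simp only [hR, curvature, Matrix.add_apply, Matrix.sub_apply]
    ring
  -- In the trace of `W` the four `P` terms cancel without symmetry of `P`, so `tr W = 0` passes to
  -- `R`. Contracting the Bianchi identity then gives the symmetry of the Ricci tensor.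
  have hRtr : ∀ μ σ, ∑ ρ, R μ σ ρ ρ = 0 := by
    intro μ σ
    have e := h.trace_Wten hU hx μ σ
    simp only [hW, Finset.sum_add_distrib, Finset.sum_sub_distrib, hlow, Finset.sum_ite_eq',
      Finset.mem_univ, if_true] at e
    linarith
  have hric : ∀ ν σ, ricci (metric ϖ) x ν σ = ∑ ρ, R ρ σ ρ ν := by
    intro ν σ
    refine Finset.sum_congr rfl fun ρ _ => ?_
    rw [hR, curvature_congr hU (fun y hy μ => Matrix.ext fun ρ' ν' => ?_) hx ρ σ]
    exact (hΓU y hy ρ' μ ν').symm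
  have hricsym : ∀ ν σ, ricci (metric ϖ) x ν σ = ricci (metric ϖ) x σ ν := by
    intro ν σ
    have e : ∑ ρ, (R ρ σ ρ ν + R σ ν ρ ρ + R ν ρ ρ σ) = 0 :=
      Finset.sum_eq_zero fun ρ _ => hbianchi ρ ν ρ σ
    simp only [Finset.sum_add_distrib, hRtr] at e
    have e2 : ∑ ρ, R ν ρ ρ σ = -∑ ρ, R ρ ν ρ σ := by
      rw [← Finset.sum_neg_distrib]
      exact Finset.sum_congr rfl fun ρ _ => hanti ρ σ ν ρ
    rw [hric, hric]
    linarith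
  set p := ∑ ρ, ∑ l, g⁻¹ ρ l * Pten ϖ x ρ l with hp
  -- Contracting `ρ` with `μ`, the trace of the delta yields `m P`, and two further terms each
  -- remove one `P`.
  have hmain : ∀ ν σ, ricci (metric ϖ) x ν σ + ((m : ℝ) - 2) * Pten ϖ x σ ν + p * g σ ν = 0 := by
    intro ν σ
    have e := hWric ν σ
    have hlow' : ∑ ρ, (∑ l, g⁻¹ ρ l * Pten ϖ x σ l) * g ρ ν = Pten ϖ x σ ν := by
      rw [← hlow σ ν]
      exact Finset.sum_congr rfl fun ρ _ => by rw [hg, metric_symm ϖ x ρ ν]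
    simp only [hW, Finset.sum_add_distrib, Finset.sum_sub_distrib, hlow', Finset.sum_ite_eq',
      Finset.mem_univ, if_true, Finset.sum_const, Finset.card_univ, Fintype.card_fin,
      nsmul_eq_mul, ← Finset.sum_mul, ← hric, ← hp] at e
    linarith
  have hm2 : (m : ℝ) - 2 ≠ 0 := by
    have : (3 : ℝ) ≤ m := by exact_mod_cast hm
    linarith
  have hm1 : (m : ℝ) - 1 ≠ 0 := by
    have : (3 : ℝ) ≤ m := by exact_mod_cast hm
    linarith
  have hPsym : ∀ μ σ, Pten ϖ x μ σ = Pten ϖ x σ μ := by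
    intro μ σ
    have e1 := hmain μ σ
    have e2 := hmain σ μ
    rw [hricsym σ μ] at e2
    rw [hg, metric_symm ϖ x σ μ] at e1
    exact mul_left_cancel₀ hm2 (by linarith)
  -- The `g`-trace of `hmain` is `R + (m-2) p + m p = 0`. Symmetry of `P` identifies its trace,
  -- taken here with transposed indices, with `p`.
  have hscal : scalarCurv (metric ϖ) x = -(2 * ((m : ℝ) - 1)) * p := by
    have hgg : ∑ ν, ∑ σ, g⁻¹ ν σ * g σ ν = m := by
      have e := congrArg Matrix.trace (Matrix.nonsing_inv_mul g hgdet)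
      rw [Matrix.trace_one, Fintype.card_fin] at e
      rw [← e]
      simp only [Matrix.trace, Matrix.diag, Matrix.mul_apply]
    have hpp : ∑ ν, ∑ σ, g⁻¹ ν σ * Pten ϖ x σ ν = p := by
      exact Finset.sum_congr rfl fun ν _ => Finset.sum_congr rfl fun σ _ => by rw [hPsym]
    have e : ∑ ν, ∑ σ, g⁻¹ ν σ * (ricci (metric ϖ) x ν σ + ((m : ℝ) - 2) * Pten ϖ x σ ν
        + p * g σ ν) = 0 := by simp only [hmain, mul_zero, Finset.sum_const_zero]
    have e' : scalarCurv (metric ϖ) x + ((m : ℝ) - 2) * ∑ ν, ∑ σ, g⁻¹ ν σ * Pten ϖ x σ ν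
        + p * ∑ ν, ∑ σ, g⁻¹ ν σ * g σ ν = 0 := by
      rw [← e, scalarCurv]
      simp only [Finset.mul_sum, ← Finset.sum_add_distrib]
      refine Finset.sum_congr rfl fun ν _ => Finset.sum_congr rfl fun σ _ => ?_
      rw [hg]
      ring
    rw [hpp, hgg] at e'
    linarith
  refine ⟨hΓU x hx, fun μ ν => ?_, hTU x hx, hWric, fun μ σ => ?_⟩
  · have e := hmain ν μ
    rw [hricsym ν μ] at e
    rw [schouten, hscal]
    have hc : -(2 * ((m : ℝ) - 1)) * p / (2 * ((m : ℝ) - 1)) = -p := by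
      field_simp
    rw [hc]
    field_simp
    rw [← hg]
    linarith
  · rw [(h.Omega0_structure hU hx μ σ).1, hPsym, sub_self]

end IsCartanConnection

end Normal

end ConformalCartan

/-! ### Assembly of the transformation laws and the normal case -/

theorem mainTheorem4 {m : ℕ} (hm : 3 ≤ m) (U : Set (Coord m)) (hU : IsOpen U)
    (ϖ : Form1 m (Idx m)) (hϖ : IsCartanConnection U ϖ)
    (z : Coord m → ℝ) (hz : ContDiffOn ℝ ∞ z U) (hzpos : ∀ x ∈ U, 0 < z x) :
    -- the matrix form of the composite fields and the relation between them
    (∀ x ∈ U, ∀ μ σ,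
      varpi0 ϖ x μ =
        block3 0 (fun ν => Pten ϖ x μ ν) 0
          (Pi.single μ 1) (Matrix.of fun ρ ν => Gam ϖ x ρ μ ν)
            (fun ρ => ∑ l, (metric ϖ x)⁻¹ ρ l * Pten ϖ x μ l)
          0 (fun ν => metric ϖ x μ ν) 0 ∧
      Omega0 ϖ x μ σ =
        block3 (f0 ϖ x μ σ) (fun ν => Cten ϖ x ν μ σ) 0
          (fun ρ => Tor ϖ x ρ μ σ) (Matrix.of fun ρ ν => Wten ϖ x ρ ν μ σ)
            (fun ρ => ∑ l, (metric ϖ x)⁻¹ ρ l * Cten ϖ x l μ σ)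
          0 (fun ν => ∑ α, Tor ϖ x α μ σ * metric ϖ x α ν) (-f0 ϖ x μ σ) ∧
      Omega0 ϖ x μ σ = curvature (varpi0 ϖ) x μ σ) ∧
    -- the composite fields transform as gauge fields with the matrix `W̄`
    (∀ x ∈ U, ∀ μ σ,
      varpi0 (weylAct z ϖ) x μ = gauge1 (varpi0 ϖ) (Wbar z ϖ) x μ ∧
      curvature (weylAct z ϖ) x μ σ = gauge2 (curvature ϖ) (weylMat z) x μ σ ∧
      Omega0 (weylAct z ϖ) x μ σ = gauge2 (Omega0 ϖ) (Wbar z ϖ) x μ σ) ∧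
    -- the transformed composite fields in matrix form
    (∀ x ∈ U, ∀ μ σ,
      varpi0 (weylAct z ϖ) x μ =
        block3 0
          (fun ν => Pten ϖ x μ ν + nablaZeta z ϖ x μ ν - zeta z x μ * zeta z x ν
            + 1 / 2 * zetaSq z ϖ x * metric ϖ x μ ν)
          0
          (Pi.single μ 1)
          (Matrix.of fun ρ ν => Gam ϖ x ρ μ ν + (if ρ = ν then zeta z x μ else 0)
            + (if ρ = μ then zeta z x ν else 0) - zetaUp z ϖ x ρ * metric ϖ x μ ν)
          (fun ρ => (z x ^ 2)⁻¹ * ∑ l, (metric ϖ x)⁻¹ ρ l *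
            (Pten ϖ x μ l + nablaZeta z ϖ x μ l - zeta z x μ * zeta z x l
              + 1 / 2 * zetaSq z ϖ x * metric ϖ x μ l))
          0
          (fun ν => z x ^ 2 * metric ϖ x μ ν)
          0 ∧
      Omega0 (weylAct z ϖ) x μ σ =
        block3 (f0 ϖ x μ σ - ∑ l, zeta z x l * Tor ϖ x l μ σ)
          (fun ν => Cten ϖ x ν μ σ - ∑ l, zeta z x l * Wten ϖ x l ν μ σ
            + (f0 ϖ x μ σ - ∑ l, zeta z x l * Tor ϖ x l μ σ) * zeta z x ν
            + 1 / 2 * zetaSq z ϖ x * ∑ α, Tor ϖ x α μ σ * metric ϖ x α ν)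
          0
          (fun ρ => Tor ϖ x ρ μ σ)
          (Matrix.of fun ρ ν => Wten ϖ x ρ ν μ σ + Tor ϖ x ρ μ σ * zeta z x ν
            - zetaUp z ϖ x ρ * ∑ α, Tor ϖ x α μ σ * metric ϖ x α ν)
          (fun ρ => (z x ^ 2)⁻¹ * ∑ k, (metric ϖ x)⁻¹ ρ k *
            (Cten ϖ x k μ σ - ∑ l, zeta z x l * Wten ϖ x l k μ σ
              + (f0 ϖ x μ σ - ∑ l, zeta z x l * Tor ϖ x l μ σ) * zeta z x k
              + 1 / 2 * zetaSq z ϖ x * ∑ α, Tor ϖ x α μ σ * metric ϖ x α k))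
          0
          (fun ν => z x ^ 2 * ∑ α, Tor ϖ x α μ σ * metric ϖ x α ν)
          (∑ l, zeta z x l * Tor ϖ x l μ σ - f0 ϖ x μ σ)) ∧
    -- the metric, the linear connection and the tensor `P`
    (∀ x ∈ U, metric (weylAct z ϖ) x = z x ^ 2 • metric ϖ x) ∧
    (∀ x ∈ U, ∀ ρ μ ν, Gam (weylAct z ϖ) x ρ μ ν =
      Gam ϖ x ρ μ ν + (if ρ = ν then zeta z x μ else 0) + (if ρ = μ then zeta z x ν else 0)
        - (∑ l, (metric ϖ x)⁻¹ ρ l * zeta z x l) * metric ϖ x μ ν) ∧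
    (∀ x ∈ U, ∀ μ ν, Pten (weylAct z ϖ) x μ ν =
      Pten ϖ x μ ν + nablaZeta z ϖ x μ ν - zeta z x μ * zeta z x ν
        + 1 / 2 * zetaSq z ϖ x * metric ϖ x μ ν) ∧
    -- the trace part, the torsion, the pseudo-Weyl tensor and the pseudo-Cotton tensor
    (∀ x ∈ U, ∀ μ σ,
      f0 ϖ x μ σ = Pten ϖ x μ σ - Pten ϖ x σ μ ∧
      f0 (weylAct z ϖ) x μ σ = Pten (weylAct z ϖ) x μ σ - Pten (weylAct z ϖ) x σ μ ∧
      f0 (weylAct z ϖ) x μ σ = f0 ϖ x μ σ - ∑ l, zeta z x l * Tor ϖ x l μ σ) ∧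
    (∀ x ∈ U, ∀ ρ μ σ,
      Tor ϖ x ρ μ σ = Gam ϖ x ρ μ σ - Gam ϖ x ρ σ μ ∧
      Tor (weylAct z ϖ) x ρ μ σ = Tor ϖ x ρ μ σ) ∧
    (∀ x ∈ U, ∀ ρ ν μ σ, Wten (weylAct z ϖ) x ρ ν μ σ =
      Wten ϖ x ρ ν μ σ + Tor ϖ x ρ μ σ * zeta z x ν
        - (∑ l, (metric ϖ x)⁻¹ ρ l * zeta z x l) * ∑ α, Tor ϖ x α μ σ * metric ϖ x α ν) ∧
    (∀ x ∈ U, ∀ ν μ σ, Cten (weylAct z ϖ) x ν μ σ =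
      Cten ϖ x ν μ σ - ∑ l, zeta z x l * Wten ϖ x l ν μ σ + zeta z x ν * f0 ϖ x μ σ
        + 1 / 2 * zetaSq z ϖ x * ∑ α, Tor ϖ x α μ σ * metric ϖ x α ν
        - (∑ l, zeta z x l * Tor ϖ x l μ σ) * zeta z x ν) ∧
    -- the normal case
    (IsNormal U ϖ → ∀ x ∈ U,
      (∀ ρ μ ν, Gam ϖ x ρ μ ν = christoffel (metric ϖ) x ρ μ ν ∧
        Gam (weylAct z ϖ) x ρ μ ν = christoffel (metric (weylAct z ϖ)) x ρ μ ν) ∧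
      (∀ μ ν, Pten ϖ x μ ν = schouten (metric ϖ) x μ ν ∧
        Pten (weylAct z ϖ) x μ ν = schouten (metric (weylAct z ϖ)) x μ ν) ∧
      (∀ ρ μ σ, Tor ϖ x ρ μ σ = 0 ∧ Tor (weylAct z ϖ) x ρ μ σ = 0) ∧
      (∀ ν σ, ∑ ρ, Wten ϖ x ρ ν ρ σ = 0 ∧ ∑ ρ, Wten (weylAct z ϖ) x ρ ν ρ σ = 0) ∧
      (∀ μ σ, f0 ϖ x μ σ = 0 ∧ f0 (weylAct z ϖ) x μ σ = 0) ∧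
      (∀ ρ ν μ σ, Wten (weylAct z ϖ) x ρ ν μ σ = Wten ϖ x ρ ν μ σ) ∧
      (∀ ν μ σ, Cten (weylAct z ϖ) x ν μ σ =
        Cten ϖ x ν μ σ - ∑ l, zeta z x l * Wten ϖ x l ν μ σ) ∧
      (∀ μ σ, Omega0 (weylAct z ϖ) x μ σ =
        block3 0 (fun ν => Cten ϖ x ν μ σ - ∑ l, zeta z x l * Wten ϖ x l ν μ σ) 0
          0 (Matrix.of fun ρ ν => Wten ϖ x ρ ν μ σ)
            (fun ρ => (z x ^ 2)⁻¹ * ∑ k, (metric ϖ x)⁻¹ ρ k *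
              (Cten ϖ x k μ σ - ∑ l, zeta z x l * Wten ϖ x l k μ σ))
          0 0 0)) := by
  have hW := hϖ.weylAct hU hz hzpos
  have hz0 : ∀ x ∈ U, z x ≠ 0 := fun x hx => (hzpos x hx).ne'
  -- Raising an index with `g^W = z² g` produces the `z⁻²` of the (2,3) entries.
  have hinv : ∀ x ∈ U, ∀ ρ (v : Fin m → ℝ), ∑ l, (metric (weylAct z ϖ) x)⁻¹ ρ l * v l
      = (z x ^ 2)⁻¹ * ∑ l, (metric ϖ x)⁻¹ ρ l * v l := by
    intro x hx ρ v
    rw [metric_inv_weylAct (hz0 x hx) (hϖ.soldering x hx), Finset.mul_sum]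
    exact Finset.sum_congr rfl fun l _ => by rw [Matrix.smul_apply, smul_eq_mul, mul_assoc]
  have hG := fun x hx μ ν => (Gam_Pten_weylAct hϖ hU hz hzpos hx μ ν (x := x)).1
  have hP := fun x hx μ ν => (Gam_Pten_weylAct hϖ hU hz hzpos hx μ ν (x := x)).2
  have hT := fun x hx μ σ => (Omega0_entries_weylAct hϖ hU hz hzpos hx μ σ (x := x)).1
  have hf := fun x hx μ σ => (Omega0_entries_weylAct hϖ hU hz hzpos hx μ σ (x := x)).2.1
  have hWt := fun x hx μ σ => (Omega0_entries_weylAct hϖ hU hz hzpos hx μ σ (x := x)).2.2.1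
  have hC := fun x hx μ σ => (Omega0_entries_weylAct hϖ hU hz hzpos hx μ σ (x := x)).2.2.2
  refine ⟨fun x hx μ σ => ⟨(hϖ.varpi0_shape hU hx μ).1, (hϖ.Omega0_shape hU hx μ σ).1,
      hϖ.curvature_varpi0 hU hx μ σ⟩,
    fun x hx μ σ => ⟨varpi0_weylAct hϖ hU hz hzpos hx μ, curvature_weylAct hϖ hU hz hzpos hx μ σ,
      Omega0_weylAct hϖ hU hz hzpos hx μ σ⟩,
    fun x hx μ σ => ⟨?_, ?_⟩, fun x hx => metric_weylAct (hz0 x hx),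
    fun x hx ρ μ ν => hG x hx μ ν ρ, hP,
    fun x hx μ σ => ⟨(hϖ.Omega0_structure hU hx μ σ).1, (hW.Omega0_structure hU hx μ σ).1,
      hf x hx μ σ⟩,
    fun x hx ρ μ σ => ⟨(hϖ.Omega0_structure hU hx μ σ).2.1 ρ, hT x hx μ σ ρ⟩,
    fun x hx ρ ν μ σ => hWt x hx μ σ ρ ν, fun x hx ν μ σ => ?_, fun hn x hx => ?_⟩
  · rw [(hW.varpi0_shape hU hx μ).1]
    simp only [hinv x hx]
    simp only [metric_weylAct (hz0 x hx), hP x hx, hG x hx]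
    rfl
  · rw [(hW.Omega0_shape hU hx μ σ).1]
    simp only [hinv x hx]
    simp only [metric_weylAct (hz0 x hx), hT x hx, hf x hx, hWt x hx, hC x hx, neg_sub,
      Matrix.smul_apply, smul_eq_mul, mul_left_comm _ (z x ^ 2), ← Finset.mul_sum]
  · rw [hC x hx]
    ring
  · obtain ⟨n1, n2, n3, n4, n5⟩ := hϖ.normal hU hn hm hx
    -- `ϖ^W` is itself a normal Cartan connection, so the statements about `g^W` need no conformal
    -- variation of the curvature.
    obtain ⟨w1, w2, w3, w4, w5⟩ := hW.normal hU (hn.weylAct hϖ hU hz hzpos) hm hx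
    have hWn : ∀ ρ ν μ σ, Wten (weylAct z ϖ) x ρ ν μ σ = Wten ϖ x ρ ν μ σ := by
      intro ρ ν μ σ
      simp [hWt x hx, n3]
    have hCn : ∀ ν μ σ, Cten (weylAct z ϖ) x ν μ σ =
        Cten ϖ x ν μ σ - ∑ l, zeta z x l * Wten ϖ x l ν μ σ := by
      intro ν μ σ
      simp [hC x hx, n3, n5]
    refine ⟨fun ρ μ ν => ⟨n1 ρ μ ν, w1 ρ μ ν⟩, fun μ ν => ⟨n2 μ ν, w2 μ ν⟩,
      fun ρ μ σ => ⟨n3 ρ μ σ, w3 ρ μ σ⟩, fun ν σ => ⟨n4 ν σ, w4 ν σ⟩,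
      fun μ σ => ⟨n5 μ σ, w5 μ σ⟩, hWn, hCn, fun μ σ => ?_⟩
    rw [(hW.Omega0_shape hU hx μ σ).1]
    simp only [hinv x hx, w3, w5, hWn, hCn, zero_mul, Finset.sum_const_zero, neg_zero]
    rfl
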